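/- Let $n\ge 2$, let $k$ be a field and $q\in k$, $q\neq 0$ (for instance $k=\mathbb C(q)$ or $\mathbb C((q))$ with $q$ an indeterminate). Let $V(z)$ have basis $z^d v_m$ ($d\in\mathbb Z$, $1\le m\le n$), and let the generators $E_j,K_j$ ($0\le j\le n-1$) of $U_q(\widehat{\mathfrak{sl}}_n)$ act on it by $E_j\cdot z^dv_m=\delta_{j,m-1}\,z^{d+\delta_{j,0}}v_{m-1}$ and $K_j\cdot z^dv_m=q^{\delta_{j,m}-\delta_{j+1,m}}z^dv_m$, indices read modulo $n$ (so $v_0=v_n$ here). *Formal action.* A pure tensor $t=z_1^{d_1}v_{m_1}\otimes z_2^{d_2}v_{m_2}\otimes\cdots$ in $V(z_1)\otimes V(z_2)\otimes\cdots$ is semi-infinite if from some factor on it is $z^ev_n\otimes z^ev_{n-1}\otimes\cdots\otimes z^ev_1\otimes z^{e+1}v_n\otimes\cdots\otimes z^{e+1}v_1\otimes\cdots$ for some $e$. On semi-infinite tensors $K_j\otimes K_j\otimes\cdots$ acts as $q^{H_j}$, where $H_j$ multiplies $t$ by the integer $$\sum_{d\in\mathbb Z}\bigl(\#\{r: t_r=E_j(z^dv_{j+1})\}-\#\{r: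 t_r=z^dv_{j+1}\}\bigr)$$ ($t_r$ is the $r$-th factor, and $E_j(z^dv_{j+1})$ is $z^dv_j$ for $j\ne0$ and $z^{d+1}v_n$ for $j=0$). The generators act by $\Delta^\infty(K_j)=K_j\otimes K_j\otimes\cdots$ and $\Delta^\infty(E_j)=\sum_{p\ge1}1\otimes\cdots\otimes1\otimes \underbrace{E_j}_{p}\otimes K_j\otimes K_j\otimes\cdots$, as formal sums of pure tensors. A formal (infinite) linear combination of semi-infinite tensors is a *highest weight vector of weight $\Lambda_i$* if it is nonzero, every $E_j$ sends it to $0$, and every $K_j$ multiplies it by $q^{\delta_{ij}}$. All infinite sums are taken coefficientwise; that they are well defined (for each pure tensor only finitely many terms contribute) is part of the claim. *$q$-antisymmetrization.* The generator $T_p$ ($p\ge1$) of the infinite Hecke algebra $H_\infty(q^2)$ acts on the right, in the factors $p,p+1$: for $\mathbf z=z_p^{d}z_{p+1}^{d'}$ and $\mathbf z^{\sigma}=z_p^{d'}z_{p+1}^{d}$, $$((v_m\otimes v_{m'})\mathbf z)T_p=\begin{cases}-q(v_{m'}\otimes v_m)\mathbf z^{\sigma}-(q^2-1)(v_m\otimes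 v_{m'})\frac{z_{p+1}\mathbf z^{\sigma}-z_p\mathbf z}{z_p-z_{p+1}}& m<m',\\ -(v_m\otimes v_{m})\mathbf z^{\sigma}-(q^2-1)(v_m\otimes v_{m})\frac{z_p(\mathbf z^{\sigma}-\mathbf z)}{z_p-z_{p+1}}& m=m',\\ -q(v_{m'}\otimes v_m)\mathbf z^{\sigma}-(q^2-1)(v_m\otimes v_{m'})\frac{z_p(\mathbf z^{\sigma}-\mathbf z)}{z_p-z_{p+1}}& m>m'.\end{cases}$$ Let $S_\infty$ be the group generated by the adjacent transpositions $\sigma_p=(p\ \,p+1)$, $p\ge 1$, and for $\sigma\in S_\infty$ put $T_\sigma=T_{p_1}\cdots T_{p_l}$, where $\sigma=\sigma_{p_1}\cdots\sigma_{p_l}$ is an expansion of minimal length. The $q$-antisymmetrization of $t$ is $z^{d_1}v_{m_1}\wedge_q z^{d_2}v_{m_2}\wedge_q\cdots=\sum_{\sigma\in S_\infty}t\cdot T_\sigma$. **Proposition.** 1. For each $i\in\{0,\dots,n-1\}$ the $q$-wedge $$v_{\Lambda_i}=zv_i\wedge_q zv_{i-1}\wedge_q\cdots\wedge_q zv_1\wedge_q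 z^2v_n\wedge_q\cdots\wedge_q z^2v_1\wedge_q z^3v_n\wedge_q\cdots$$ (for $i=0$: $zv_n\wedge_q\cdots\wedge_q zv_1\wedge_q z^2v_n\wedge_q\cdots$) is well defined and is a highest weight vector of weight $\Lambda_i$. 2. If two adjacent factors of a semi-infinite tensor are equal, $z_p^{d}v_m\otimes z_{p+1}^{d}v_m$, then its $q$-antisymmetrization is well defined and equal to $0$. -/

import Mathlib

namespace QWedge

/-! ### Infinite pure tensors and formal infinite sums of them -/

/-- Basis vectors of the evaluation module `V(z)` for `n` colours: the pair `(d, c)` stands for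
`z ^ d • v_{c+1}`, so that `v_1, ..., v_n` correspond to `c = 0, ..., n - 1`. -/
abbrev Basis (n : ℕ) : Type := ℤ × Fin n

/-- Infinite pure tensors `z₁^{d₁} v_{m₁} ⊗ z₂^{d₂} v_{m₂} ⊗ ...` of basis vectors.
The factor written first has index `0`. -/
abbrev PureTensor (n : ℕ) : Type := ℕ → Basis n

/-- Finite linear combinations of infinite pure tensors. -/
abbrev FinVector (k : Type*) [Field k] (n : ℕ) : Type _ := PureTensor n →₀ k

/-- Formal (possibly infinite) linear combinations of infinite pure tensors, given by the
coefficient of each pure tensor. -/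
abbrev FormalVector (k : Type*) (n : ℕ) : Type _ := PureTensor n → k

/-- The periodic tensor
`z^e v_n ⊗ z^e v_{n-1} ⊗ ... ⊗ z^e v_1 ⊗ z^{e+1} v_n ⊗ ... ⊗ z^{e+1} v_1 ⊗ z^{e+2} v_n ⊗ ...`. -/
def periodicTensor (n : ℕ) [NeZero n] (e : ℤ) : PureTensor n :=
  fun r => (e + ((r / n : ℕ) : ℤ), Fin.rev (Fin.ofNat n r))

/-- A pure tensor is semi-infinite if from some factor on it is a periodic tensor. -/
def IsSemiInfinite {n : ℕ} [NeZero n] (t : PureTensor n) : Prop :=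
  ∃ (N : ℕ) (e : ℤ), ∀ r : ℕ, t (N + r) = periodicTensor n e r

/-- The tensor `z v_i ⊗ z v_{i-1} ⊗ ... ⊗ z v_1 ⊗ z² v_n ⊗ ... ⊗ z² v_1 ⊗ z³ v_n ⊗ ...`,
where for `i = 0` the first factor `z v_0` means `z v_n`. It is obtained from
`z v_n ⊗ z v_{n-1} ⊗ ...` by removing the first `n - i` factors (none for `i = 0`). -/
def vacuumTensor (n : ℕ) [NeZero n] (i : Fin n) : PureTensor n :=
  fun r => periodicTensor n 1 (r + (n - (i : ℕ)) % n)

/-- The family `f` of formal vectors sums to `g` coefficientwise: for each pure tensor `s` only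
finitely many members of the family involve `s`, and their coefficients at `s` add up to that
of `g`. -/
def HasFormalSum {ι k : Type*} [Field k] {n : ℕ} (f : ι → FormalVector k n)
    (g : FormalVector k n) : Prop :=
  ∀ s : PureTensor n, (Function.support fun a => f a s).Finite ∧ ∑ᶠ a, f a s = g s

/-! ### The formal action of the generators given by the infinite coproduct -/

/-- The vector `E_j (z^d v_{j+1})` of `V(z)`: it is `z^d v_j` for `j ≠ 0` and
`z^{d+1} v_n` for `j = 0`. The operator `E_j` kills `z^d v_m` unless `m = j + 1`. -/
def raise {n : ℕ} [NeZero n] (j : Fin n) (d : ℤ) : Basis n :=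
  (if j = 0 then d + 1 else d, j - 1)

/-- The integer by which `H_j` acts on a semi-infinite pure tensor: the sum over `d` of
the number of factors equal to `E_j (z^d v_{j+1})` minus the number of factors equal to
`z^d v_{j+1}`. For a semi-infinite tensor both numbers are finite for every `d` and their
difference vanishes for all but finitely many `d`. On a single basis vector this is the usual
weight `δ_{j,m} - δ_{j+1,m}` of `z^d v_m`, indices modulo `n`. -/
noncomputable def hWeight {n : ℕ} [NeZero n] (j : Fin n) (t : PureTensor n) : ℤ :=
  ∑ᶠ d : ℤ, (({r : ℕ | t r = raise j d}.ncard : ℤ) - ({r : ℕ | t r = (d, j)}.ncard : ℤ))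

open Classical in
/-- `K_j ⊗ K_j ⊗ K_j ⊗ ...` acting on a pure tensor, as `q ^ H_j`. -/
noncomputable def actK {k : Type*} [Field k] (q : k) {n : ℕ} [NeZero n] (j : Fin n)
    (t : PureTensor n) : FormalVector k n :=
  q ^ hWeight j t • Pi.single t 1

open Classical in
/-- `1 ⊗ ... ⊗ 1 ⊗ E_j ⊗ K_j ⊗ K_j ⊗ ...` acting on a pure tensor, with `E_j` in the factor of
index `p`. -/
noncomputable def actEAt {k : Type*} [Field k] (q : k) {n : ℕ} [NeZero n] (j : Fin n)
    (t : PureTensor n) (p : ℕ) : FormalVector k n :=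
  if (t p).2 = j then
    q ^ hWeight j (fun r => t (p + 1 + r)) • Pi.single (Function.update t p (raise j (t p).1)) 1
  else 0

/-- `E_j` acting on a pure tensor through the infinite coproduct
`∑ p, 1 ⊗ ... ⊗ 1 ⊗ E_j ⊗ K_j ⊗ K_j ⊗ ...`. The sum is a formal one; a pure tensor `s` occurs
in at most one of its summands, because the `p`-th summand is a multiple of a tensor
that differs from `t` precisely in the factor `p`. -/
noncomputable def actE {k : Type*} [Field k] (q : k) {n : ℕ} [NeZero n] (j : Fin n)
    (t : PureTensor n) : FormalVector k n :=
  fun s => ∑ᶠ p : ℕ, actEAt q j t p s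

/-- The operator that is given on pure tensors by `A` sends the formal vector `v = ∑ v_t t` to
`w`: the formal sum `∑ v_t A(t)` is well defined and equal to `w`. -/
def FormallyMapsTo {k : Type*} [Field k] {n : ℕ} (A : PureTensor n → FormalVector k n)
    (v w : FormalVector k n) : Prop :=
  HasFormalSum (fun t => v t • A t) w

/-- The fundamental weight `Λ_i`, given by its values on `H_0, ..., H_{n-1}`. -/
def fundamentalWeight {n : ℕ} (i : Fin n) : Fin n → ℤ := Pi.single i 1

/-- `v` is a highest weight vector of weight `lam` for the formal action: it is a nonzero formal
sum of semi-infinite pure tensors, `E_j v = 0` and `K_j v = q ^ lam(H_j) v` for all `j`. -/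
structure IsHighestWeightVector {k : Type*} [Field k] (q : k) {n : ℕ} [NeZero n]
    (lam : Fin n → ℤ) (v : FormalVector k n) : Prop where
  ne_zero : v ≠ 0
  semiInfinite : ∀ t, v t ≠ 0 → IsSemiInfinite t
  actE_eq_zero : ∀ j, FormallyMapsTo (actE q j) v 0
  actK_eq : ∀ j, FormallyMapsTo (actK q j) v (q ^ lam j • v)

/-! ### The action of the infinite Hecke algebra -/

/-- Laurent polynomials in the two variables attached to two adjacent factors. -/
abbrev Laurent₂ (k : Type*) [Field k] : Type _ := AddMonoidAlgebra k (ℤ × ℤ)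

/-- The monomial `x ^ a * y ^ b`. -/
noncomputable def mon (k : Type*) [Field k] (a b : ℤ) : Laurent₂ k :=
  AddMonoidAlgebra.single (a, b) 1

/-- The quotient `(x ^ b * y ^ a - x ^ a * y ^ b) / (x - y)`, see `sub_mul_divDiff`.
One of the two sums is always empty. -/
noncomputable def divDiff (k : Type*) [Field k] (a b : ℤ) : Laurent₂ k :=
  ∑ l ∈ Finset.range (b - a).toNat, mon k (a + l) (b - 1 - l) -
    ∑ l ∈ Finset.range (a - b).toNat, mon k (b + l) (a - 1 - l)

theorem mon_mul_mon (k : Type*) [Field k] (a b c d : ℤ) :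
    mon k a b * mon k c d = mon k (a + c) (b + d) := by
  simp [mon, AddMonoidAlgebra.single_mul_single]

theorem sub_mul_sum_mon (k : Type*) [Field k] (a b : ℤ) (m : ℕ) :
    (mon k 1 0 - mon k 0 1) * ∑ l ∈ Finset.range m, mon k (a + l) (b - 1 - l) =
      mon k (a + m) (b - m) - mon k a b := by
  induction m with
  | zero => simp
  | succ m ih =>
    rw [Finset.sum_range_succ, mul_add, ih, sub_mul, mon_mul_mon, mon_mul_mon]
    have e1 : (1 : ℤ) + (a + m) = a + ((m + 1 : ℕ) : ℤ) := by push_cast; ring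
    have e2 : (0 : ℤ) + (b - 1 - m) = b - ((m + 1 : ℕ) : ℤ) := by push_cast; ring
    have e3 : (0 : ℤ) + (a + m) = a + m := by ring
    have e4 : (1 : ℤ) + (b - 1 - m) = b - m := by ring
    rw [e1, e2, e3, e4]
    abel

theorem sub_mul_divDiff (k : Type*) [Field k] (a b : ℤ) :
    (mon k 1 0 - mon k 0 1) * divDiff k a b = mon k b a - mon k a b := by
  rw [divDiff, mul_sub, sub_mul_sum_mon, sub_mul_sum_mon]
  rcases le_total a b with h | h
  · have h1 : ((b - a).toNat : ℤ) = b - a := Int.toNat_of_nonneg (by omega)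
    have h2 : (a - b).toNat = 0 := by omega
    rw [h1, h2]
    simp
  · have h1 : ((a - b).toNat : ℤ) = a - b := Int.toNat_of_nonneg (by omega)
    have h2 : (b - a).toNat = 0 := by omega
    rw [h1, h2]
    simp

/-- The element `(v_{c+1} ⊗ v_{c'+1}) · f` of `V(x) ⊗ V(y)`, for a Laurent polynomial `f`. -/
noncomputable def colourTensor {k : Type*} [Field k] {n : ℕ} (c c' : Fin n) (f : Laurent₂ k) :
    (Basis n × Basis n) →₀ k :=
  Finsupp.mapDomain (fun e => ((e.1, c), (e.2, c'))) f.coeff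

/-- The Hecke generator acting on the pure tensor `u ⊗ w = (v_m ⊗ v_{m'}) · x^d y^{d'}` in
`V(x) ⊗ V(y)`. With `𝐳 = x^d y^{d'}` and `𝐳^σ = x^{d'} y^d` it is
* `-q (v_{m'} ⊗ v_m) 𝐳^σ - (q²-1) (v_m ⊗ v_{m'}) (y 𝐳^σ - x 𝐳) / (x - y)` if `m < m'`,
* `-(v_m ⊗ v_m) 𝐳^σ - (q²-1) (v_m ⊗ v_m) x (𝐳^σ - 𝐳) / (x - y)` if `m = m'`,
* `-q (v_{m'} ⊗ v_m) 𝐳^σ - (q²-1) (v_m ⊗ v_{m'}) x (𝐳^σ - 𝐳) / (x - y)` if `m > m'`.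
In the first case `y 𝐳^σ = x^{d'} y^{d+1}` and `x 𝐳 = x^{d+1} y^{d'}`. -/
noncomputable def heckeTwo {k : Type*} [Field k] (q : k) {n : ℕ} (u w : Basis n) :
    (Basis n × Basis n) →₀ k :=
  if u.2 < w.2 then
    -(q • colourTensor w.2 u.2 (mon k w.1 u.1)) -
      (q ^ 2 - 1) • colourTensor u.2 w.2 (divDiff k (u.1 + 1) w.1)
  else if u.2 = w.2 then
    -colourTensor u.2 w.2 (mon k w.1 u.1) -
      (q ^ 2 - 1) • colourTensor u.2 w.2 (mon k 1 0 * divDiff k u.1 w.1)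
  else
    -(q • colourTensor w.2 u.2 (mon k w.1 u.1)) -
      (q ^ 2 - 1) • colourTensor u.2 w.2 (mon k 1 0 * divDiff k u.1 w.1)

/-- The (right) action of the Hecke generator `T` of index `p` on infinite tensors, in
the adjacent factors of index `p` and `p + 1`. -/
noncomputable def heckeT {k : Type*} [Field k] (q : k) {n : ℕ} (p : ℕ) :
    FinVector k n →ₗ[k] FinVector k n :=
  Finsupp.linearCombination k fun t : PureTensor n =>
    Finsupp.mapDomain
      (fun xy : Basis n × Basis n => Function.update (Function.update t p xy.1) (p + 1) xy.2)
      (heckeTwo q (t p) (t (p + 1)))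

/-- The adjacent transposition of `p` and `p + 1`. -/
def adj (p : ℕ) : Equiv.Perm ℕ := Equiv.swap p (p + 1)

/-- The infinite symmetric group, generated by the adjacent transpositions. -/
def SInf : Subgroup (Equiv.Perm ℕ) := Subgroup.closure (Set.range adj)

/-- The product of adjacent transpositions spelled by a word. -/
def wordProd (l : List ℕ) : Equiv.Perm ℕ := (l.map adj).prod

/-- `l` spells a minimal length expansion of `σ` in terms of adjacent transpositions. -/
def IsReducedWord (l : List ℕ) (σ : Equiv.Perm ℕ) : Prop :=
  wordProd l = σ ∧ ∀ l' : List ℕ, wordProd l' = σ → l.length ≤ l'.length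

theorem exists_word (σ : SInf) : ∃ l : List ℕ, wordProd l = σ := by
  obtain ⟨σ, hσ⟩ := σ
  refine Subgroup.closure_induction (p := fun x _ => ∃ l : List ℕ, wordProd l = x)
    ?_ ?_ ?_ ?_ hσ
  · rintro _ ⟨p, rfl⟩
    exact ⟨[p], by simp [wordProd]⟩
  · exact ⟨[], by simp [wordProd]⟩
  · rintro _ _ _ _ ⟨l, rfl⟩ ⟨l', rfl⟩
    exact ⟨l ++ l', by simp [wordProd]⟩
  · rintro _ _ ⟨l, rfl⟩
    refine ⟨l.reverse, ?_⟩
    have h : ∀ p : ℕ, (adj p)⁻¹ = adj p := fun p => Equiv.swap_inv _ _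
    simp [wordProd, List.prod_inv_reverse, List.map_reverse, Function.comp_def, h]

theorem exists_isReducedWord (σ : SInf) : ∃ l : List ℕ, IsReducedWord l σ := by
  obtain ⟨l, hl⟩ := exists_word σ
  have hS : {l : List ℕ | wordProd l = σ}.Nonempty := ⟨l, hl⟩
  exact ⟨Function.argminOn List.length _ hS, Function.argminOn_mem List.length _ hS,
    fun l' hl' => Function.argminOn_le List.length _ hl'⟩

/-- A minimal length expansion of `σ` in terms of adjacent transpositions. -/
noncomputable def reducedWord (σ : SInf) : List ℕ := Classical.choose (exists_isReducedWord σ)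

theorem reducedWord_spec (σ : SInf) : IsReducedWord (reducedWord σ) σ :=
  Classical.choose_spec (exists_isReducedWord σ)

/-- The right action `x ↦ x · T_{p₁} T_{p₂} ⋯ T_{p_l}` of a word: `T_{p₁}` is applied first. -/
noncomputable def heckeWord {k : Type*} [Field k] (q : k) {n : ℕ} (l : List ℕ)
    (x : FinVector k n) : FinVector k n :=
  l.foldl (fun y p => heckeT q p y) x

/-- The right action of the basis element `T_σ = T_{p₁} ⋯ T_{p_l}` of the infinite Hecke algebra,
where `p₁, ..., p_l` is a minimal length expansion of `σ`. -/
noncomputable def heckeTσ {k : Type*} [Field k] (q : k) {n : ℕ} (σ : SInf)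
    (x : FinVector k n) : FinVector k n :=
  heckeWord q (reducedWord σ) x

/-- `v` is the `q`-antisymmetrization `∑ σ, t · T_σ` of the pure tensor `t`: the sum is well
defined coefficient by coefficient and equal to `v`. -/
def IsQAntisymmetrization {k : Type*} [Field k] (q : k) {n : ℕ} (t : PureTensor n)
    (v : FormalVector k n) : Prop :=
  HasFormalSum (fun σ : SInf => (⇑(heckeTσ q σ (Finsupp.single t 1)) : FormalVector k n)) v

end QWedge

/-!
The formula for the Hecke generator `T_p` has the shape of an operator on rational functions: if a
linear combination of pure tensors is read as a family of Laurent polynomials, one for each sequence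
of colours (`part`), then `T_p` is a combination of the identity, of the exchange of two variables and
of the exchange of two variables and colours, with coefficients in the field of fractions (`heckeFun`,
`part_heckeT`). In this form two facts become identities between rational functions in three, resp. two
variables: the braid relations (`heckeFun_braid`) and the commutation of `T_p` with `E ⊗ K + 1 ⊗ E`
(`heckeFun_raiseFun`). By the former and Matsumoto's theorem (`foldl_eq_of_reduced`), `T_σ` does not
depend on the reduced word, so that `T_σ T_p = T_{σ σ_p}` and `T_p T_σ = T_{σ_p σ}` whenever the
lengths add up.

*The sums are finite.* Order the basis vectors of `V(z)` as in the semi-infinite tensors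
`..., z^e v_n, ..., z^e v_1, z^{e+1} v_n, ...` (`pos`). A Hecke generator either exchanges two factors,
or it keeps their colours and produces no basis vector beyond the larger one; in the second case
the right factor gets smaller if it was the larger one (`HeckeStep`). So if the factor `t_Q` is
beyond all the factors before it, a tensor in `t · T_σ` can have a factor as large as `t_Q` only
in the place to which `σ` moves it (`pos_lt_of_heckeTσ`). A tensor that agrees with `t` from the place
`R` on, for large `R`, therefore only gets contributions from the finitely many `σ` that fix all numbers
from `R` on (`fixesFrom_of_heckeTσ_ne_zero`).

*Equal adjacent factors.* If the factors `p` and `p + 1` of `t` are equal, then `t · T_p = -t`. So the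
terms of `σ` and `σ_p σ` cancel in the sum over the permutations of the first factors, and
the antisymmetrization vanishes (`sum_heckeTσ_eq_zero`).

*The vacuum.* Let `t` be the vacuum tensor, whose factors run through successive basis vectors. Applying
`E_j` to a factor turns it into the next one, so that `E_j t` is a sum of tensors with two equal adjacent
factors. To use this for the coefficient of a tensor `s` in `E_j` of the antisymmetrization, let `P` be
so large that `s` and `t` agree from `P` on, and choose it such that `E_j` kills the factor `t_P`. Raising
a factor after `P` to get `s` would need a tensor in which two factors are equal to the smaller one of
their counterparts in `t`, and the antisymmetrization of `t` has no such term
(`heckeTσ_eq_zero_of_repeated`). Hence up to a common power of `q` the coefficient is that of `s` in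
the truncation of `E_j` to the factors up to `P`, applied to a finite sum of the `t · T_σ`
(`smul_actE_apply`). The truncation commutes with these `T_σ`, and the result is `0` by the previous
paragraph. Finally, the Hecke action permutes the colours, so that all tensors in the antisymmetrization
have the same weight as `t`, and that of `t` is determined by the basis vector right before its first
factor, which has the colour `i` (`hWeight_congr`, `hWeight_vacuumTensor`). The antisymmetrization
is nonzero because the coefficient of `t` is `1` (`antisymmetrization_self`).
-/

namespace QWedge

/-! ### Reduced words in the infinite symmetric group -/

theorem adj_mul_self (p : ℕ) : adj p * adj p = 1 := Equiv.swap_mul_self _ _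

theorem adj_lt_adj {p i j : ℕ} (hij : i < j) (h : ¬(i = p ∧ j = p + 1)) : adj p i < adj p j := by
  simp only [adj, Equiv.swap_apply_def]
  split_ifs <;> omega

theorem adj_apply_left (p : ℕ) : adj p p = p + 1 := Equiv.swap_apply_left _ _

theorem adj_apply_right (p : ℕ) : adj p (p + 1) = p := Equiv.swap_apply_right _ _

theorem adj_apply_of_ne {p r : ℕ} (h1 : r ≠ p) (h2 : r ≠ p + 1) : adj p r = r :=
  Equiv.swap_apply_of_ne_of_ne h1 h2

theorem adj_adj (p r : ℕ) : adj p (adj p r) = r := Equiv.swap_apply_self _ _ _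

/-- The inversions of a permutation. -/
def invSet (σ : Equiv.Perm ℕ) : Set (ℕ × ℕ) := {a | a.1 < a.2 ∧ σ a.2 < σ a.1}

/-- The number of inversions of a permutation (`0` if there are infinitely many). -/
noncomputable def invNum (σ : Equiv.Perm ℕ) : ℕ := (invSet σ).ncard

/-- The permutation moves only numbers below `M`. -/
def FixesFrom (M : ℕ) (σ : Equiv.Perm ℕ) : Prop := ∀ r, M ≤ r → σ r = r

theorem FixesFrom.mono {M M' : ℕ} {σ : Equiv.Perm ℕ} (h : FixesFrom M σ) (hM : M ≤ M') :
    FixesFrom M' σ := fun r hr => h r (hM.trans hr)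

theorem FixesFrom.mul {M : ℕ} {σ τ : Equiv.Perm ℕ} (h : FixesFrom M σ) (h' : FixesFrom M τ) :
    FixesFrom M (σ * τ) := fun r hr => by rw [Equiv.Perm.mul_apply, h' r hr, h r hr]

theorem FixesFrom.inv {M : ℕ} {σ : Equiv.Perm ℕ} (h : FixesFrom M σ) : FixesFrom M σ⁻¹ :=
  fun r hr => by rw [Equiv.Perm.inv_eq_iff_eq, h r hr]

theorem FixesFrom.lt {M : ℕ} {σ : Equiv.Perm ℕ} (h : FixesFrom M σ) {r : ℕ} (hr : r < M) :
    σ r < M := by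
  by_contra hc
  have := σ.injective (h (σ r) (by omega))
  omega

theorem fixesFrom_adj {p M : ℕ} (h : p + 1 < M) : FixesFrom M (adj p) :=
  fun r hr => adj_apply_of_ne (by omega) (by omega)

theorem exists_fixesFrom {σ : Equiv.Perm ℕ} (hσ : σ ∈ SInf) : ∃ M, FixesFrom M σ := by
  refine Subgroup.closure_induction (p := fun x _ => ∃ M, FixesFrom M x) ?_ ?_ ?_ ?_ hσ
  · rintro _ ⟨p, rfl⟩
    exact ⟨p + 2, fixesFrom_adj (by omega)⟩
  · exact ⟨0, fun _ _ => rfl⟩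
  · rintro x y _ _ ⟨M, hM⟩ ⟨M', hM'⟩
    exact ⟨max M M', (hM.mono (le_max_left _ _)).mul (hM'.mono (le_max_right _ _))⟩
  · rintro x _ ⟨M, hM⟩
    exact ⟨M, hM.inv⟩

theorem adj_mem (p : ℕ) : adj p ∈ SInf := Subgroup.subset_closure ⟨p, rfl⟩

theorem wordProd_mem (l : List ℕ) : wordProd l ∈ SInf := by
  apply Subgroup.list_prod_mem
  intro x hx
  obtain ⟨p, -, rfl⟩ := List.mem_map.1 hx
  exact adj_mem p

theorem wordProd_append (l l' : List ℕ) : wordProd (l ++ l') = wordProd l * wordProd l' := by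
  simp [wordProd]

theorem wordProd_singleton (p : ℕ) : wordProd [p] = adj p := by simp [wordProd]

theorem finite_invSet {σ : Equiv.Perm ℕ} (hσ : σ ∈ SInf) : (invSet σ).Finite := by
  obtain ⟨M, hM⟩ := exists_fixesFrom hσ
  refine ((Set.finite_Iio M).prod (Set.finite_Iio M)).subset ?_
  rintro ⟨i, j⟩ ⟨h1, h2⟩
  simp only at h1 h2
  have hj : j < M := by
    by_contra hc
    have h3 := hM j (by omega)
    have h4 := σ.injective (hM (σ i) (by omega))
    omega
  exact ⟨show i < M by omega, hj⟩

theorem invNum_mul_adj_of_lt {σ : Equiv.Perm ℕ} (hσ : σ ∈ SInf) {p : ℕ} (h : σ p < σ (p + 1)) :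
    invNum (σ * adj p) = invNum σ + 1 := by
  have key : invSet (σ * adj p) =
      insert (p, p + 1) (Prod.map (adj p) (adj p) '' invSet σ) := by
    ext ⟨i, j⟩
    simp only [invSet, Set.mem_ofPred_eq, Equiv.Perm.mul_apply, Set.mem_insert_iff, Set.mem_image,
      Prod.exists, Prod.map_apply, Prod.mk.injEq]
    constructor
    · rintro ⟨h1, h2⟩
      by_cases hp : i = p ∧ j = p + 1
      · exact Or.inl hp
      · exact Or.inr ⟨adj p i, adj p j, ⟨adj_lt_adj h1 hp, h2⟩, adj_adj _ _, adj_adj _ _⟩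
    · rintro (⟨rfl, rfl⟩ | ⟨a, b, ⟨h1, h2⟩, rfl, rfl⟩)
      · rw [adj_apply_left, adj_apply_right]
        exact ⟨by omega, h⟩
      · rw [adj_adj, adj_adj]
        refine ⟨adj_lt_adj h1 ?_, h2⟩
        rintro ⟨rfl, rfl⟩
        omega
  rw [invNum, key, Set.ncard_insert_of_notMem _ ((finite_invSet hσ).image _),
    Set.ncard_image_of_injective _ ((adj p).injective.prodMap (adj p).injective), invNum]
  rintro ⟨⟨a, b⟩, ⟨h1, h2⟩, h3⟩
  simp only [Prod.map_apply, Prod.mk.injEq] at h1 h2 h3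
  have ha : a = p + 1 := by rw [← adj_adj p a, h3.1, adj_apply_left]
  have hb : b = p := by rw [← adj_adj p b, h3.2, adj_apply_right]
  omega

theorem mul_adj_mul_adj (σ : Equiv.Perm ℕ) (p : ℕ) : σ * adj p * adj p = σ := by
  rw [mul_assoc, adj_mul_self, mul_one]

theorem invNum_of_descent {σ : Equiv.Perm ℕ} (hσ : σ ∈ SInf) {p : ℕ} (h : σ (p + 1) < σ p) :
    invNum σ = invNum (σ * adj p) + 1 := by
  have := invNum_mul_adj_of_lt (σ := σ * adj p) (SInf.mul_mem hσ (adj_mem p)) (p := p)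
    (by simpa only [Equiv.Perm.mul_apply, adj_apply_left, adj_apply_right] using h)
  rwa [mul_adj_mul_adj] at this

theorem ne_of_perm (σ : Equiv.Perm ℕ) (p : ℕ) : σ p ≠ σ (p + 1) := fun h => by
  have := σ.injective h
  omega

theorem invNum_mul_adj_le {σ : Equiv.Perm ℕ} (hσ : σ ∈ SInf) (p : ℕ) :
    invNum (σ * adj p) ≤ invNum σ + 1 := by
  rcases lt_or_gt_of_ne (ne_of_perm σ p) with h | h
  · exact (invNum_mul_adj_of_lt hσ h).le
  · have := invNum_of_descent hσ h
    omega

theorem invNum_one : invNum 1 = 0 := by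
  have : invSet 1 = ∅ := by
    ext ⟨i, j⟩
    simp only [invSet, Set.mem_ofPred_eq, Equiv.Perm.one_apply, Set.mem_empty_iff_false, iff_false]
    omega
  rw [invNum, this, Set.ncard_empty]

theorem invNum_wordProd_le (l : List ℕ) : invNum (wordProd l) ≤ l.length := by
  induction l using List.reverseRecOn with
  | nil => simp [wordProd, invNum_one]
  | append_singleton l p ih =>
    rw [wordProd_append, wordProd_singleton, List.length_append, List.length_singleton]
    exact (invNum_mul_adj_le (wordProd_mem l) p).trans (by omega)

theorem exists_descent {M : ℕ} {σ : Equiv.Perm ℕ} (hM : FixesFrom M σ) (h1 : σ ≠ 1) :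
    ∃ p, p + 1 < M ∧ σ (p + 1) < σ p := by
  by_contra! hc
  apply h1
  have hmono : StrictMono σ := by
    refine strictMono_nat_of_lt_succ fun p => ?_
    refine lt_of_le_of_ne ?_ (ne_of_perm σ p)
    by_cases hp : p + 1 < M
    · exact hc p hp
    · rw [hM (p + 1) (by omega)]
      by_contra hlt
      have := σ.injective (hM (σ p) (by omega))
      omega
  have hmono' : StrictMono σ.symm := fun a b hab => by
    rw [← hmono.lt_iff_lt]
    simpa using hab
  ext r
  refine le_antisymm ?_ (hmono.le_apply)
  have := hmono'.le_apply (x := σ r)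
  rwa [Equiv.symm_apply_apply] at this

/-- Induction over the permutations of `{0, ..., M - 1}` by right multiplication with adjacent
transpositions that increase the length. -/
theorem ascent_induction {M : ℕ} {P : Equiv.Perm ℕ → Prop} (one : P 1)
    (step : ∀ σ ∈ SInf, FixesFrom M σ → ∀ p, p + 1 < M → σ p < σ (p + 1) → P σ → P (σ * adj p)) :
    ∀ σ ∈ SInf, FixesFrom M σ → P σ := by
  intro σ hσ hM
  induction hm : invNum σ generalizing σ with
  | zero =>
    by_cases h1 : σ = 1
    · exact h1 ▸ one
    · obtain ⟨p, -, hp⟩ := exists_descent hM h1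
      have := invNum_of_descent hσ hp
      omega
  | succ m ih =>
    by_cases h1 : σ = 1
    · exact h1 ▸ one
    · obtain ⟨p, hpM, hp⟩ := exists_descent hM h1
      have h2 := invNum_of_descent hσ hp
      have hσ' := SInf.mul_mem hσ (adj_mem p)
      have hM' := hM.mul (fixesFrom_adj hpM)
      have := step _ hσ' hM' p hpM
        (by simpa only [Equiv.Perm.mul_apply, adj_apply_left, adj_apply_right] using hp)
        (ih _ hσ' hM' (by omega))
      rwa [mul_adj_mul_adj] at this

theorem exists_word_length_eq_invNum {σ : Equiv.Perm ℕ} (hσ : σ ∈ SInf) :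
    ∃ l : List ℕ, wordProd l = σ ∧ l.length = invNum σ := by
  obtain ⟨M, hM⟩ := exists_fixesFrom hσ
  refine ascent_induction (M := M)
    (P := fun σ => ∃ l : List ℕ, wordProd l = σ ∧ l.length = invNum σ)
    ⟨[], by simp [wordProd], by simp [invNum_one]⟩ ?_ σ hσ hM
  rintro σ hσ - p - hp ⟨l, hl, hl'⟩
  exact ⟨l ++ [p], by rw [wordProd_append, wordProd_singleton, hl],
    by rw [invNum_mul_adj_of_lt hσ hp, List.length_append, hl', List.length_singleton]⟩

/-- The length of a permutation is the number of its inversions. -/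
theorem isReducedWord_iff {l : List ℕ} {σ : Equiv.Perm ℕ} :
    IsReducedWord l σ ↔ wordProd l = σ ∧ l.length = invNum σ := by
  constructor
  · rintro ⟨rfl, h⟩
    obtain ⟨l', h1, h2⟩ := exists_word_length_eq_invNum (wordProd_mem l)
    exact ⟨rfl, le_antisymm (h2 ▸ h l' h1) (invNum_wordProd_le l)⟩
  · rintro ⟨rfl, h⟩
    exact ⟨rfl, fun l' hl' => h ▸ hl' ▸ invNum_wordProd_le l'⟩

theorem adj_comm {p r : ℕ} (h : p + 1 < r) : adj p * adj r = adj r * adj p := by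
  ext i
  simp only [adj, Equiv.Perm.mul_apply, Equiv.swap_apply_def]
  split_ifs <;> omega

theorem adj_braid (p : ℕ) : adj p * adj (p + 1) * adj p = adj (p + 1) * adj p * adj (p + 1) := by
  ext i
  simp only [adj, Equiv.Perm.mul_apply, Equiv.swap_apply_def]
  split_ifs <;> omega

theorem invNum_eq_of_descent {l : List ℕ} {p : ℕ}
    (h : (l ++ [p]).length = invNum (wordProd (l ++ [p]))) :
    l.length = invNum (wordProd l) ∧ wordProd (l ++ [p]) (p + 1) < wordProd (l ++ [p]) p := by
  rw [wordProd_append, wordProd_singleton, List.length_append, List.length_singleton] at *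
  have h1 := invNum_wordProd_le l
  have h2 := invNum_mul_adj_le (wordProd_mem l) p
  refine ⟨by omega, ?_⟩
  by_contra hc
  have h3 := invNum_mul_adj_of_lt (σ := wordProd l * adj p)
    (SInf.mul_mem (wordProd_mem l) (adj_mem p)) (p := p)
    (lt_of_le_of_ne (not_lt.1 hc) (ne_of_perm _ p))
  rw [mul_adj_mul_adj] at h3
  omega

/-- Matsumoto's theorem for the infinite symmetric group: operators that satisfy the braid
relations give the same result along any two reduced words of a permutation. -/
theorem foldl_eq_of_reduced {X : Type*} (f : ℕ → X → X)
    (far : ∀ p r x, p + 1 < r → f p (f r x) = f r (f p x))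
    (braid : ∀ p x, f p (f (p + 1) (f p x)) = f (p + 1) (f p (f (p + 1) x))) (x : X)
    {l l' : List ℕ} (h : wordProd l = wordProd l') (hl : l.length = invNum (wordProd l))
    (hl' : l'.length = invNum (wordProd l)) :
    l.foldl (fun y p => f p y) x = l'.foldl (fun y p => f p y) x := by
  induction hm : l.length using Nat.strong_induction_on generalizing l l' with
  | _ m ih =>
  have hlen : l.length = l'.length := by rw [hl, hl']
  rcases l.eq_nil_or_concat' with rfl | ⟨l₁, p, rfl⟩
  · rw [List.length_eq_zero_iff.1 (hlen.symm.trans List.length_nil)]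
  rcases l'.eq_nil_or_concat' with rfl | ⟨l₂, r, rfl⟩
  · simp at hlen
  set π := wordProd (l₁ ++ [p]) with hπ
  have hπm : π ∈ SInf := wordProd_mem _
  obtain ⟨hl₁, hdp⟩ := invNum_eq_of_descent hl
  obtain ⟨hl₂, hdr⟩ := invNum_eq_of_descent (hl'.trans (congrArg invNum h))
  rw [← hπ] at hdp
  rw [← h] at hdr
  have e₁ : wordProd l₁ = π * adj p := by
    rw [hπ, wordProd_append, wordProd_singleton, mul_adj_mul_adj]
  have e₂ : wordProd l₂ = π * adj r := by
    rw [h, wordProd_append, wordProd_singleton, mul_adj_mul_adj]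
  rw [List.length_append, List.length_singleton] at hm
  simp only [List.foldl_append, List.foldl_cons, List.foldl_nil]
  -- By induction all reduced words of `π * adj p` give the same result. So the parts before the
  -- last letters `p` and `r` may be replaced by words after which a braid relation applies.
  have cmp : ∀ (p : ℕ) (l₁ l₃ : List ℕ), wordProd l₁ = π * adj p →
      l₁.length = invNum (wordProd l₁) → l₁.length < m → wordProd l₃ = π * adj p → l₃.length = l₁.length →
      l₁.foldl (fun y p => f p y) x = l₃.foldl (fun y p => f p y) x := by
    intro p l₁ l₃ h1 h2 h3 h4 h5
    exact ih _ h3 (h1.trans h4.symm) h2 (h5.trans h2) rfl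
  have hlen' : l₂.length = l₁.length := by simpa using hlen.symm
  have invp := invNum_of_descent hπm hdp
  rw [← e₁, ← hl₁] at invp
  have main_far : ∀ (p r : ℕ) (l₁ l₂ : List ℕ), p + 1 < r → wordProd l₁ = π * adj p →
      wordProd l₂ = π * adj r → l₁.length = invNum (wordProd l₁) → l₂.length = invNum (wordProd l₂) →
      l₁.length < m → l₂.length = l₁.length → π (p + 1) < π p → π (r + 1) < π r →
      f p (l₁.foldl (fun y p => f p y) x) = f r (l₂.foldl (fun y p => f p y) x) := by
    intro p r l₁ l₂ hpr e₁ e₂ hl₁ hl₂ hlt hlen' hdp hdr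
    have h1 := invNum_of_descent hπm hdp
    have h2 := invNum_of_descent (σ := π * adj p) (SInf.mul_mem hπm (adj_mem p)) (p := r) (by
      rw [Equiv.Perm.mul_apply, Equiv.Perm.mul_apply, adj_apply_of_ne (by omega) (by omega),
        adj_apply_of_ne (by omega) (by omega)]
      exact hdr)
    obtain ⟨l₃, h3, h3'⟩ := exists_word_length_eq_invNum
      (SInf.mul_mem (SInf.mul_mem hπm (adj_mem p)) (adj_mem r))
    rw [← e₁, ← hl₁] at h1
    rw [← e₁, ← hl₁, e₁, ← h3'] at h2
    rw [cmp p l₁ (l₃ ++ [r]) e₁ hl₁ hlt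
        (by rw [wordProd_append, wordProd_singleton, h3, mul_adj_mul_adj])
        (by rw [List.length_append, List.length_singleton, h2]),
      cmp r l₂ (l₃ ++ [p]) e₂ hl₂ (by omega)
        (by rw [wordProd_append, wordProd_singleton, h3, mul_assoc π, adj_comm hpr, ← mul_assoc,
          mul_adj_mul_adj])
        (by rw [List.length_append, List.length_singleton, hlen', h2])]
    simp only [List.foldl_append, List.foldl_cons, List.foldl_nil]
    exact far p r _ hpr
  have main_braid : ∀ (p : ℕ) (l₁ l₂ : List ℕ), wordProd l₁ = π * adj p →
      wordProd l₂ = π * adj (p + 1) → l₁.length = invNum (wordProd l₁) →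
      l₂.length = invNum (wordProd l₂) →
      l₁.length < m → l₂.length = l₁.length → π (p + 1) < π p → π (p + 2) < π (p + 1) →
      f p (l₁.foldl (fun y p => f p y) x) = f (p + 1) (l₂.foldl (fun y p => f p y) x) := by
    intro p l₁ l₂ e₁ e₂ hl₁ hl₂ hlt hlen' hdp hdr
    have m1 := SInf.mul_mem hπm (adj_mem p)
    have m2 := SInf.mul_mem m1 (adj_mem (p + 1))
    have h2 := invNum_of_descent m1 (p := p + 1) (by
      rw [Equiv.Perm.mul_apply, Equiv.Perm.mul_apply, adj_apply_of_ne (by omega) (by omega),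
        adj_apply_right]
      exact hdr.trans hdp)
    have h3 := invNum_of_descent m2 (p := p) (by
      simp only [Equiv.Perm.mul_apply]
      rw [adj_apply_left, adj_apply_of_ne (p := p) (r := p + 1 + 1) (by omega) (by omega),
        adj_apply_of_ne (p := p + 1) (r := p) (by omega) (by omega), adj_apply_left]
      exact hdr)
    obtain ⟨l₃, h4, h4'⟩ := exists_word_length_eq_invNum (SInf.mul_mem m2 (adj_mem p))
    rw [← e₁, ← hl₁, e₁] at h2
    rw [← h4'] at h3
    rw [cmp p l₁ (l₃ ++ [p, p + 1]) e₁ hl₁ hlt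
        (by
          rw [wordProd_append, h4, show [p, p + 1] = [p] ++ [p + 1] from rfl, wordProd_append,
            wordProd_singleton, wordProd_singleton, ← mul_assoc, mul_adj_mul_adj,
            mul_adj_mul_adj])
        (by simp only [List.length_append, List.length_cons, List.length_nil]; omega),
      cmp (p + 1) l₂ (l₃ ++ [p + 1, p]) e₂ hl₂ (by omega)
        (by
          rw [wordProd_append, h4, show [p + 1, p] = [p + 1] ++ [p] from rfl, wordProd_append,
            wordProd_singleton, wordProd_singleton,
            show π * adj p * adj (p + 1) * adj p = π * (adj p * adj (p + 1) * adj p) by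
              simp only [mul_assoc],
            adj_braid, ← mul_assoc, ← mul_assoc, ← mul_assoc, mul_adj_mul_adj,
            mul_adj_mul_adj])
        (by simp only [List.length_append, List.length_cons, List.length_nil]; omega)]
    simp only [List.foldl_append, List.foldl_cons, List.foldl_nil]
    exact braid p _
  rcases lt_trichotomy p r with hpr | rfl | hpr
  · rcases (Nat.succ_le_of_lt hpr).lt_or_eq with h1 | rfl
    · exact main_far p r l₁ l₂ h1 e₁ e₂ hl₁ hl₂ (by omega) hlen' hdp hdr
    · exact main_braid p l₁ l₂ e₁ e₂ hl₁ hl₂ (by omega) hlen' hdp hdr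
  · rw [cmp p l₁ l₂ e₁ hl₁ (by omega) e₂ hlen']
  · rcases (Nat.succ_le_of_lt hpr).lt_or_eq with h1 | rfl
    · exact (main_far r p l₂ l₁ h1 e₂ e₁ hl₂ hl₁ (by omega) hlen'.symm hdr hdp).symm
    · exact (main_braid r l₂ l₁ e₂ e₁ hl₂ hl₁ (by omega) hlen'.symm hdr hdp).symm

theorem invNum_inv (σ : Equiv.Perm ℕ) : invNum σ⁻¹ = invNum σ := by
  have : invSet σ⁻¹ = (fun a : ℕ × ℕ => (σ a.2, σ a.1)) '' invSet σ := by
    ext ⟨i, j⟩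
    simp only [invSet, Set.mem_ofPred_eq, Set.mem_image, Prod.mk.injEq, Prod.exists]
    constructor
    · rintro ⟨h1, h2⟩
      exact ⟨σ⁻¹ j, σ⁻¹ i, ⟨h2, by simpa using h1⟩, by simp, by simp⟩
    · rintro ⟨a, b, ⟨h1, h2⟩, rfl, rfl⟩
      exact ⟨h2, by simpa using h1⟩
  rw [invNum, this, Set.ncard_image_of_injective, invNum]
  rintro ⟨a, b⟩ ⟨c, d⟩ h
  simp only [Prod.mk.injEq, EmbeddingLike.apply_eq_iff_eq] at h
  rw [h.1, h.2]

theorem invNum_adj_mul_of_lt {σ : Equiv.Perm ℕ} (hσ : σ ∈ SInf) {p : ℕ} (h : σ⁻¹ p < σ⁻¹ (p + 1)) :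
    invNum (adj p * σ) = invNum σ + 1 := by
  rw [← invNum_inv, mul_inv_rev, show (adj p)⁻¹ = adj p from Equiv.swap_inv _ _,
    invNum_mul_adj_of_lt (SInf.inv_mem hσ) h, invNum_inv]

end QWedge
namespace QWedge

/-! ### The Hecke generators on rational functions in few variables -/

/-- Coefficient of the term of the Hecke generator that exchanges colours and variables. -/
def swapCoeff {K α : Type*} [Field K] [LinearOrder α] (q : K) (a b : α) : K :=
  if a = b then -1 else -q

/-- Coefficient of the identity in the Hecke generator,
as a rational function of the two variables. -/
def idCoeff {K : Type*} [Field K] (q x y : K) : K := (q ^ 2 - 1) * x / (x - y)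

/-- The Hecke generator in two adjacent factors with the variables `x` and `y`. A vector is encoded
by the function `F` that sends a pair of colours to the coefficient (a function of the variables)
of the tensor with these colours, and `s` is the exchange of the variables. -/
def heckeFun {K α : Type*} [Field K] [LinearOrder α] (q : K) (s : K →+* K) (x y : K)
    (F : α → α → K) (a b : α) : K :=
  swapCoeff q a b * s (F b a) + ((if a < b then q ^ 2 - 1 else 0) - idCoeff q x y) * s (F a b) +
    idCoeff q x y * F a b

set_option maxRecDepth 4000 in
set_option linter.unusedSimpArgs false in
/-- The braid relation. The coefficients of the identity for the three pairs of variables satisfy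
a quadratic relation, and the two sides differ by an explicit multiple of it. -/
theorem heckeFun_braid {K α : Type*} [Field K] [LinearOrder α] {q x y z : K}
    (hxy : x ≠ y) (hyz : y ≠ z) (hxz : x ≠ z) {s t : K →+* K}
    (sq : s q = q) (tq : t q = q) (sx : s x = y) (sy : s y = x) (sz : s z = z)
    (tx : t x = x) (ty : t y = z) (tz : t z = y) (ss : ∀ f, s (s f) = f) (tt : ∀ f, t (t f) = f)
    (sts : ∀ f, s (t (s f)) = t (s (t f))) (F : α → α → α → K) (a b c : α) :
    heckeFun q s x y (fun a b => heckeFun q t y z (fun b c =>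
      heckeFun q s x y (fun a b => F a b c) a b) b c) a b =
    heckeFun q t y z (fun b c => heckeFun q s x y (fun a b =>
      heckeFun q t y z (fun b c => F a b c) b c) a b) b c := by
  have h1 : x - y ≠ 0 := sub_ne_zero.2 hxy
  have h2 : y - z ≠ 0 := sub_ne_zero.2 hyz
  have h3 : x - z ≠ 0 := sub_ne_zero.2 hxz
  have h1' : y - x ≠ 0 := sub_ne_zero.2 hxy.symm
  have h2' : z - y ≠ 0 := sub_ne_zero.2 hyz.symm
  obtain ⟨h, hh⟩ : ∃ h, h = idCoeff q x y := ⟨_, rfl⟩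
  obtain ⟨h', hh'⟩ : ∃ h, h = idCoeff q y z := ⟨_, rfl⟩
  obtain ⟨h'', hh''⟩ : ∃ h, h = idCoeff q x z := ⟨_, rfl⟩
  have rel : h * h' = h'' * (h + h' - (q ^ 2 - 1)) := by
    rw [hh, hh', hh'', idCoeff, idCoeff, idCoeff]
    field_simp
    ring
  have sh : s h = q ^ 2 - 1 - h := by
    simp only [hh, idCoeff, map_div₀, map_mul, map_sub, map_pow, map_one, sq, sx, sy]
    field_simp
    ring
  have th' : t h' = q ^ 2 - 1 - h' := by
    simp only [hh', idCoeff, map_div₀, map_mul, map_sub, map_pow, map_one, tq, ty, tz]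
    field_simp
    ring
  have sh' : s h' = h'' := by
    simp only [hh', hh'', idCoeff, map_div₀, map_mul, map_sub, map_pow, map_one, sq, sy, sz]
  have sh'' : s h'' = h' := by rw [← sh', ss]
  have th : t h = h'' := by
    simp only [hh, hh'', idCoeff, map_div₀, map_mul, map_sub, map_pow, map_one, tq, tx, ty]
  have th'' : t h'' = h := by rw [← th, tt]
  unfold heckeFun
  rw [← hh, ← hh']
  clear hh hh' hh'' h1 h2 h3 h1' h2' sx sy sz tx ty tz hxy hyz hxz
  -- the difference of the two sides is this multiple of `rel`, whatever the order of the colours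
  have key := congrArg (fun e => e *
    ((h - h') * F a b c + ((if a < b then q ^ 2 - 1 else 0) - h) * s (F a b c) +
      swapCoeff q a b * s (F b a c) + (h' - (if b < c then q ^ 2 - 1 else 0)) * t (F a b c) -
      swapCoeff q b c * t (F a c b) + ((if b < c then q ^ 2 - 1 else 0) -
        (if a < b then q ^ 2 - 1 else 0)) * t (s (t (F a b c))) +
      swapCoeff q b c * t (s (t (F a c b))) - swapCoeff q a b * t (s (t (F b a c))))) rel
  by_cases eab : a = b
  · subst eab
    by_cases eac : a = c
    · subst eac
      simp only [swapCoeff, map_add, map_mul, map_sub, map_neg, map_one, map_pow, map_zero, sq, tq,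
        sh, sh', sh'', th, th', th'', ss, tt, sts, lt_irrefl, if_true, if_false] at key ⊢
      linear_combination key
    · rcases lt_or_gt_of_ne eac with hac | hac <;>
      · simp only [swapCoeff, map_add, map_mul, map_sub, map_neg, map_one, map_pow, map_zero, sq,
      tq,
          sh, sh', sh'', th, th', th'', ss, tt, sts, lt_irrefl, if_true, if_false, hac, hac.ne,
          hac.ne', hac.not_gt] at key ⊢
        linear_combination key
  by_cases ebc : b = c
  · subst ebc
    rcases lt_or_gt_of_ne eab with hab | hab <;>
    · simp only [swapCoeff, map_add, map_mul, map_sub, map_neg, map_one, map_pow, map_zero, sq, tq,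
        sh, sh', sh'', th, th', th'', ss, tt, sts, lt_irrefl, if_true, if_false, hab, hab.ne,
        hab.ne', hab.not_gt] at key ⊢
      linear_combination key
  by_cases eac : a = c
  · subst eac
    rcases lt_or_gt_of_ne eab with hab | hab <;>
    · simp only [swapCoeff, map_add, map_mul, map_sub, map_neg, map_one, map_pow, map_zero, sq, tq,
        sh, sh', sh'', th, th', th'', ss, tt, sts, lt_irrefl, if_true, if_false, hab, hab.ne,
        hab.ne', hab.not_gt] at key ⊢
      linear_combination key
  rcases lt_or_gt_of_ne eab with hab | hab <;> rcases lt_or_gt_of_ne ebc with hbc | hbc <;>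
    rcases lt_or_gt_of_ne eac with hac | hac <;>
    first
    | exact absurd (hab.trans hbc) hac.not_gt
    | exact absurd (hbc.trans hab) hac.not_gt
    | (simp only [swapCoeff, map_add, map_mul, map_sub, map_neg, map_one, map_pow, map_zero, sq, tq,
         sh, sh', sh'', th, th', th'', ss, tt, sts, lt_irrefl, if_true, if_false,
         hab, hab.ne, hab.ne', hab.not_gt, hbc, hbc.ne, hbc.ne', hbc.not_gt,
         hac, hac.ne, hac.ne', hac.not_gt] at key ⊢
       linear_combination key)

/-- The eigenvalue of `K` on the vectors of colour `c`, where `E` takes the colour `j` to the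
colour `i`. -/
def colourFactor {K α : Type*} [Field K] [DecidableEq α] (q : K) (i j c : α) : K :=
  if c = i then q else if c = j then q⁻¹ else 1

/-- The operator `E ⊗ K + 1 ⊗ E` on two adjacent factors, in the encoding of `heckeFun`. Here `E`
takes the colour `j` to the colour `i`, and it multiplies by `X` in the left factor and by `Y`
in the right one. -/
def raiseFun {K α : Type*} [Field K] [DecidableEq α] (q : K) (i j : α) (X Y : K)
    (F : α → α → K) (a b : α) : K :=
  (if a = i then X * colourFactor q i j b * F j b else 0) + if b = i then Y * F a j else 0

set_option linter.unusedSimpArgs false in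
/-- The Hecke generator commutes with `E ⊗ K + 1 ⊗ E`. The two cases of `hij` are that of `E_0`,
which
takes the least colour to the greatest one and multiplies by the variable, and that of the
other `E_j`, which take a colour to its predecessor. -/
theorem heckeFun_raiseFun {K α : Type*} [Field K] [LinearOrder α] {q x y X Y : K} (hq : q ≠ 0)
    (hxy : x ≠ y) {i j : α} {s : K →+* K} (sq : s q = q) (sX : s X = Y) (sY : s Y = X)
    (sx : s x = y) (sy : s y = x)
    (hij : (X = x ∧ Y = y ∧ j < i ∧ ∀ c, c ≠ i → c ≠ j → j < c ∧ c < i) ∨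
      (X = 1 ∧ Y = 1 ∧ i < j ∧ ∀ c, c ≠ i → c ≠ j → (c < i ∧ c < j) ∨ (i < c ∧ j < c)))
    (F : α → α → K) (a b : α) :
    heckeFun q s x y (raiseFun q i j X Y F) a b = raiseFun q i j X Y (heckeFun q s x y F) a b := by
  have h1 : x - y ≠ 0 := sub_ne_zero.2 hxy
  by_cases ha : a = i <;> by_cases hb : b = i
  · subst ha hb
    rcases hij with ⟨rfl, rfl, hlt, -⟩ | ⟨rfl, rfl, hlt, -⟩ <;>
    · simp only [heckeFun, raiseFun, swapCoeff, idCoeff, colourFactor, map_add, map_mul, map_sub,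
        sq, sx, sy, map_one, lt_irrefl, if_true, if_false, hlt, hlt.ne, hlt.ne', hlt.not_gt]
      field_simp
      ring
  · subst ha
    by_cases hbj : b = j
    · subst hbj
      rcases hij with ⟨rfl, rfl, hlt, -⟩ | ⟨rfl, rfl, hlt, -⟩ <;>
      · simp only [heckeFun, raiseFun, swapCoeff, idCoeff, colourFactor, map_add, map_mul, map_sub,
          sq, sx, sy, map_one, map_zero, map_inv₀, lt_irrefl, if_true, if_false, hlt, hlt.ne,
          hlt.ne', hlt.not_gt]
        field_simp
        ring
    · rcases hij with ⟨rfl, rfl, hlt, h⟩ | ⟨rfl, rfl, hlt, h⟩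
      · obtain ⟨h3, h4⟩ := h b hb hbj
        simp only [heckeFun, raiseFun, swapCoeff, idCoeff, colourFactor, map_add, map_mul, map_sub,
          sq, sx, sy, map_one, map_zero, map_inv₀, lt_irrefl, if_true, if_false, hb, hbj, h3,
          h3.ne, h3.ne', h3.not_gt, h4, h4.ne, h4.ne', h4.not_gt]
        field_simp
        ring
      · rcases h b hb hbj with ⟨h3, h4⟩ | ⟨h3, h4⟩ <;>
        · simp only [heckeFun, raiseFun, swapCoeff, idCoeff, colourFactor, map_add, map_mul,
        map_sub,
            sq, sx, sy, map_one, map_zero, map_inv₀, lt_irrefl, if_true, if_false, hb, hbj, h3,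
            h3.ne, h3.ne', h3.not_gt, h4, h4.ne, h4.ne', h4.not_gt]
          field_simp
          ring
  · subst hb
    by_cases haj : a = j
    · subst haj
      rcases hij with ⟨rfl, rfl, hlt, -⟩ | ⟨rfl, rfl, hlt, -⟩ <;>
      · simp only [heckeFun, raiseFun, swapCoeff, idCoeff, colourFactor, map_add, map_mul, map_sub,
          sq, sx, sy, map_one, map_zero, map_inv₀, lt_irrefl, if_true, if_false, hlt, hlt.ne,
          hlt.ne', hlt.not_gt]
        field_simp
        ring
    · rcases hij with ⟨rfl, rfl, hlt, h⟩ | ⟨rfl, rfl, hlt, h⟩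
      · obtain ⟨h3, h4⟩ := h a ha haj
        simp only [heckeFun, raiseFun, swapCoeff, idCoeff, colourFactor, map_add, map_mul, map_sub,
          sq, sx, sy, map_one, map_zero, map_inv₀, lt_irrefl, if_true, if_false, ha, haj, h3,
          h3.ne, h3.ne', h3.not_gt, h4, h4.ne, h4.ne', h4.not_gt]
        field_simp
        ring
      · rcases h a ha haj with ⟨h3, h4⟩ | ⟨h3, h4⟩ <;>
        · simp only [heckeFun, raiseFun, swapCoeff, idCoeff, colourFactor, map_add, map_mul,
        map_sub,
            sq, sx, sy, map_one, map_zero, map_inv₀, lt_irrefl, if_true, if_false, ha, haj, h3,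
            h3.ne, h3.ne', h3.not_gt, h4, h4.ne, h4.ne', h4.not_gt]
          field_simp
          ring
  · simp [heckeFun, raiseFun, ha, hb]

end QWedge
namespace QWedge

/-! ### Pure tensors as monomials in infinitely many variables -/

/-- The sequence `f` with the entries of index `p` and `p + 1` replaced by `a` and `b`. -/
def put {β : Type*} (p : ℕ) (f : ℕ → β) (a b : β) : ℕ → β :=
  Function.update (Function.update f p a) (p + 1) b

section put

variable {β γ : Type*} (p : ℕ) (f : ℕ → β) (a b a' b' : β)

@[simp] theorem put_left : put p f a b p = a := by simp [put]

@[simp] theorem put_right : put p f a b (p + 1) = b := by simp [put]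

theorem put_of_ne {r : ℕ} (h : r ≠ p) (h' : r ≠ p + 1) : put p f a b r = f r := by
  simp [put, h, h']

@[simp] theorem put_put : put p (put p f a b) a' b' = put p f a' b' := by
  ext r
  by_cases h : r = p
  · simp [h]
  by_cases h' : r = p + 1
  · simp [h']
  simp [put_of_ne, h, h']

@[simp] theorem put_self : put p f (f p) (f (p + 1)) = f := by
  ext r
  by_cases h : r = p
  · simp [h]
  by_cases h' : r = p + 1
  · simp [h']
  simp [put_of_ne, h, h']

theorem comp_put (g : β → γ) : (fun r => g (put p f a b r)) =
    put p (fun r => g (f r)) (g a) (g b) := by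
  ext r
  by_cases h : r = p
  · simp [h]
  by_cases h' : r = p + 1
  · simp [h']
  simp [put_of_ne, h, h']

theorem put_comp_adj : (fun r => put p f a b (adj p r)) = put p f b a := by
  ext r
  by_cases h : r = p
  · simp [h, adj_apply_left]
  by_cases h' : r = p + 1
  · simp [h', adj_apply_right]
  simp [put_of_ne, h, h', adj_apply_of_ne h h']

theorem put_comm_far {p r : ℕ} (h : p + 1 < r) (c d : β) :
    put p (put r f c d) a b = put r (put p f a b) c d := by
  unfold put
  rw [Function.update_comm (a := r + 1) (b := p) (by omega),
    Function.update_comm (a := r) (b := p) (by omega),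
    Function.update_comm (a := r + 1) (b := p + 1) (by omega),
    Function.update_comm (a := r) (b := p + 1) (by omega)]

theorem put_eq_iff {g : ℕ → β} : f = put p g a b ↔
    f p = a ∧ f (p + 1) = b ∧ ∀ r, r ≠ p → r ≠ p + 1 → f r = g r := by
  constructor
  · intro h
    rw [h]
    exact ⟨put_left .., put_right .., fun r h h' => put_of_ne _ _ _ _ h h'⟩
  · rintro ⟨rfl, rfl, h⟩
    ext r
    by_cases h1 : r = p
    · simp [h1]
    by_cases h2 : r = p + 1
    · simp [h2]
    rw [put_of_ne _ _ _ _ h1 h2, h r h1 h2]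

end put

/-- Laurent polynomials in the variables of all factors. An exponent is an arbitrary function
`ℕ → ℤ`, so that the degrees of any pure tensor form one. -/
abbrev DegAlg (k : Type*) [Field k] : Type _ := AddMonoidAlgebra k (ℕ → ℤ)

/-- The field of fractions of `DegAlg k`, in which the divided differences of the Hecke action
become honest fractions. -/
abbrev DegField (k : Type*) [Field k] : Type _ := FractionRing (DegAlg k)

variable {k : Type*} [Field k]

/-- The monomial with the exponents `d`. -/
noncomputable def monomialOf (k : Type*) [Field k] (d : ℕ → ℤ) : DegField k :=
  algebraMap (DegAlg k) (DegField k) (AddMonoidAlgebra.single d 1)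

theorem monomialOf_mul (d e : ℕ → ℤ) : monomialOf k d * monomialOf k e = monomialOf k (d + e) := by
  rw [monomialOf, monomialOf, ← map_mul, AddMonoidAlgebra.single_mul_single, one_mul, monomialOf]

theorem monomialOf_injective : Function.Injective (monomialOf k) := fun d e h => by
  have := IsFractionRing.injective (DegAlg k) (DegField k) h
  exact (AddMonoidAlgebra.single_left_inj one_ne_zero).1 this

/-- The variable attached to the factor of index `p`. -/
noncomputable def var (k : Type*) [Field k] (p : ℕ) : DegField k := monomialOf k (Pi.single p 1)

theorem var_injective : Function.Injective (var k) := fun p r h => by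
  by_contra hpr
  have := congrFun (monomialOf_injective h) p
  simp [hpr] at this

/-- Permutation of the variables, on Laurent polynomials. -/
noncomputable def permAlg (k : Type*) [Field k] (σ : Equiv.Perm ℕ) : DegAlg k ≃ₐ[k] DegAlg k :=
  AddMonoidAlgebra.domCongr k k
    { toFun := fun d r => d (σ⁻¹ r)
      invFun := fun d r => d (σ r)
      left_inv := fun d => by simp
      right_inv := fun d => by simp
      map_add' := fun _ _ => rfl }

/-- Permutation of the variables, on rational functions. -/
noncomputable def permField (k : Type*) [Field k] (σ : Equiv.Perm ℕ) : DegField k →+* DegField k :=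
  (IsFractionRing.ringEquivOfRingEquiv (permAlg k σ).toRingEquiv :
    DegField k ≃+* DegField k).toRingHom

theorem permField_algebraMap (σ : Equiv.Perm ℕ) (a : DegAlg k) :
    permField k σ (algebraMap (DegAlg k) (DegField k) a) = algebraMap _ _ (permAlg k σ a) :=
  IsFractionRing.ringEquivOfRingEquiv_algebraMap _ _

theorem permField_monomialOf (σ : Equiv.Perm ℕ) (d : ℕ → ℤ) :
    permField k σ (monomialOf k d) = monomialOf k fun r => d (σ⁻¹ r) := by
  rw [monomialOf, permField_algebraMap, permAlg, AddMonoidAlgebra.domCongr_single]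
  rfl

theorem permField_var (σ : Equiv.Perm ℕ) (p : ℕ) : permField k σ (var k p) = var k (σ p) := by
  rw [var, permField_monomialOf, var]
  congr 1
  ext r
  have h : (σ⁻¹ r = p) ↔ (r = σ p) := Equiv.Perm.inv_eq_iff_eq
  simp only [Pi.single_apply, h]

theorem permField_algebraMap_base (σ : Equiv.Perm ℕ) (a : k) :
    permField k σ (algebraMap k (DegField k) a) = algebraMap k (DegField k) a := by
  rw [IsScalarTower.algebraMap_apply k (DegAlg k) (DegField k), permField_algebraMap,
    AlgEquiv.commutes]

theorem permField_smul (σ : Equiv.Perm ℕ) (a : k) (f : DegField k) :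
    permField k σ (a • f) = a • permField k σ f := by
  rw [Algebra.smul_def, map_mul, permField_algebraMap_base, Algebra.smul_def]

theorem permField_mul (σ τ : Equiv.Perm ℕ) (f : DegField k) :
    permField k (σ * τ) f = permField k σ (permField k τ f) := by
  suffices h : permField k (σ * τ) = (permField k σ).comp (permField k τ) by rw [h]; rfl
  refine IsLocalization.ringHom_ext (nonZeroDivisors (DegAlg k)) (AddMonoidAlgebra.ringHom_ext ?_ ?_)
  · intro r
    have : (AddMonoidAlgebra.single 0 r : DegAlg k) = algebraMap k (DegAlg k) r := rfl
    simp only [RingHom.comp_apply, this]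
    rw [← IsScalarTower.algebraMap_apply k (DegAlg k) (DegField k), permField_algebraMap_base,
      permField_algebraMap_base, permField_algebraMap_base]
  · intro d
    change permField k (σ * τ) (monomialOf k d) = permField k σ (permField k τ (monomialOf k d))
    simp only [permField_monomialOf, mul_inv_rev, Equiv.Perm.mul_apply]

theorem permField_one (f : DegField k) : permField k 1 f = f := by
  suffices h : permField k 1 = RingHom.id _ by rw [h]; rfl
  refine IsLocalization.ringHom_ext (nonZeroDivisors (DegAlg k)) (AddMonoidAlgebra.ringHom_ext ?_ ?_)
  · intro r
    have : (AddMonoidAlgebra.single 0 r : DegAlg k) = algebraMap k (DegAlg k) r := rfl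
    simp only [RingHom.comp_apply, this]
    rw [← IsScalarTower.algebraMap_apply k (DegAlg k) (DegField k), permField_algebraMap_base]
    rfl
  · intro d
    change permField k 1 (monomialOf k d) = monomialOf k d
    simp only [permField_monomialOf, inv_one, Equiv.Perm.one_apply]

variable {n : ℕ}

theorem pairing_injective (c : ℕ → Fin n) :
    Function.Injective fun (d : ℕ → ℤ) (r : ℕ) => (d r, c r) := fun d e h => by
  ext r
  exact congrArg Prod.fst (congrFun h r)

/-- The part of a linear combination of pure tensors in which the factors have the colours `c`, as
a Laurent polynomial in the variables of the factors. -/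
noncomputable def part (x : FinVector k n) (c : ℕ → Fin n) : DegField k :=
  algebraMap (DegAlg k) (DegField k)
    (AddMonoidAlgebra.ofCoeff (Finsupp.lcomapDomain (R := k) _ (pairing_injective c) x))

theorem part_injective : Function.Injective (part : FinVector k n → _) := fun x y h => by
  ext t
  have h1 := IsFractionRing.injective (DegAlg k) (DegField k) (congrFun h fun r => (t r).2)
  exact DFunLike.congr_fun (AddMonoidAlgebra.ofCoeff_injective h1) fun r => (t r).1

theorem part_add (x y : FinVector k n) : part (x + y) = part x + part y := by
  ext c
  simp only [part, map_add, AddMonoidAlgebra.ofCoeff_add, Pi.add_apply]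

theorem part_smul (a : k) (x : FinVector k n) : part (a • x) = a • part x := by
  ext c
  simp only [part, map_smul, AddMonoidAlgebra.ofCoeff_smul, Pi.smul_apply]
  exact (Algebra.linearMap (DegAlg k) (DegField k)).restrictScalars k |>.map_smul a _

theorem part_zero : part (0 : FinVector k n) = 0 := by
  ext c
  simp [part]

/-- `part` as a linear map. -/
noncomputable def partₗ : FinVector k n →ₗ[k] (ℕ → Fin n) → DegField k where
  toFun := part
  map_add' := part_add
  map_smul' := part_smul

open Classical in
theorem part_single (t : PureTensor n) (c : ℕ → Fin n) :
    part (Finsupp.single t (1 : k)) c =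
      if (fun r => (t r).2) = c then monomialOf k fun r => (t r).1 else 0 := by
  have : (Finsupp.lcomapDomain (R := k) _ (pairing_injective c) (Finsupp.single t (1 : k))) =
      if (fun r => (t r).2) = c then Finsupp.single (fun r => (t r).1) 1 else 0 := by
    ext d
    rw [Finsupp.lcomapDomain_apply, Finsupp.comapDomain_apply, Finsupp.single_apply]
    split_ifs with h1 h2 h2
    · subst h1
      simp
    · exact absurd (by subst h1; rfl) h2
    · rw [Finsupp.single_apply, if_neg]
      rintro rfl
      subst h2
      exact h1 rfl
    · rfl
  rw [part, this]
  split_ifs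
  · rfl
  · simp

end QWedge
namespace QWedge

/-! ### The Hecke generators on rational functions -/

variable {k : Type*} [Field k] {n : ℕ}

/-- The Hecke generator of index `p` on families of rational functions indexed by the colours. -/
noncomputable def heckeOp (q : k) (p : ℕ) (Φ : (ℕ → Fin n) → DegField k) (c : ℕ → Fin n) :
    DegField k :=
  heckeFun (algebraMap k (DegField k) q) (permField k (adj p)) (var k p) (var k (p + 1))
    (fun a b => Φ (put p c a b)) (c p) (c (p + 1))

/-- The product of a Laurent polynomial in the variables of index `p` and `p + 1` with the monomial
in the other variables with the exponents `d`. -/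
noncomputable def insertPoly (p : ℕ) (d : ℕ → ℤ) : Laurent₂ k →ₗ[k] DegField k :=
  (Algebra.linearMap (DegAlg k) (DegField k)).restrictScalars k ∘ₗ
    AddMonoidAlgebra.mapDomainLinearMap k k fun e : ℤ × ℤ => put p d e.1 e.2

theorem insertPoly_mon (p : ℕ) (d : ℕ → ℤ) (a b : ℤ) :
    insertPoly p d (mon k a b) = monomialOf k (put p d a b) := by
  simp [insertPoly, mon, monomialOf]

theorem laurent_induction {P : Laurent₂ k → Prop} (f : Laurent₂ k) (zero : P 0)
    (add : ∀ f g, P f → P g → P (f + g)) (smul : ∀ (r : k) (a b : ℤ), P (r • mon k a b)) : P f := by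
  induction f using AddMonoidAlgebra.induction_linear with
  | zero => exact zero
  | add f g hf hg => exact add f g hf hg
  | single e r => simpa [mon] using smul r e.1 e.2

theorem monomialOf_put_add (p : ℕ) (d : ℕ → ℤ) (a b : ℤ) :
    monomialOf k (put p d (1 + a) b) = var k p * monomialOf k (put p d a b) ∧
      monomialOf k (put p d a (1 + b)) = var k (p + 1) * monomialOf k (put p d a b) := by
  rw [var, var, monomialOf_mul, monomialOf_mul]
  constructor
  · congr 1
    symm
    rw [put_eq_iff]
    exact ⟨by simp, by simp, fun r h h' => by simp [h, put_of_ne, h']⟩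
  · congr 1
    symm
    rw [put_eq_iff]
    exact ⟨by simp, by simp, fun r h h' => by simp [h, put_of_ne, h']⟩

theorem insertPoly_left_mul (p : ℕ) (d : ℕ → ℤ) (f : Laurent₂ k) :
    insertPoly p d (mon k 1 0 * f) = var k p * insertPoly p d f := by
  induction f using laurent_induction with
  | zero => simp
  | add f g hf hg => rw [mul_add, map_add, map_add, hf, hg, mul_add]
  | smul r a b =>
    rw [mul_smul_comm, mon_mul_mon, zero_add, map_smul, map_smul, insertPoly_mon, insertPoly_mon,
      (monomialOf_put_add p d a b).1, mul_smul_comm]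

theorem insertPoly_right_mul (p : ℕ) (d : ℕ → ℤ) (f : Laurent₂ k) :
    insertPoly p d (mon k 0 1 * f) = var k (p + 1) * insertPoly p d f := by
  induction f using laurent_induction with
  | zero => simp
  | add f g hf hg => rw [mul_add, map_add, map_add, hf, hg, mul_add]
  | smul r a b =>
    rw [mul_smul_comm, mon_mul_mon, zero_add, map_smul, map_smul, insertPoly_mon, insertPoly_mon,
      (monomialOf_put_add p d a b).2, mul_smul_comm]

theorem var_sub_ne_zero (p : ℕ) : var k p - var k (p + 1) ≠ 0 :=
  sub_ne_zero.2 (var_injective.ne (by omega))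

/-- Among rational functions the divided difference is a genuine quotient. -/
theorem insertPoly_divDiff (p : ℕ) (d : ℕ → ℤ) (a b : ℤ) :
    insertPoly p d (divDiff k a b) =
      (monomialOf k (put p d b a) - monomialOf k (put p d a b)) / (var k p - var k (p + 1)) := by
  rw [eq_div_iff (var_sub_ne_zero p), mul_comm, sub_mul, ← insertPoly_left_mul,
    ← insertPoly_right_mul, ← map_sub, ← sub_mul, sub_mul_divDiff, map_sub, insertPoly_mon,
    insertPoly_mon]

open Classical in
theorem part_insert_colourTensor (p : ℕ) (t : PureTensor n) (a b : Fin n) (f : Laurent₂ k)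
    (c : ℕ → Fin n) :
    part (Finsupp.mapDomain (fun e : Basis n × Basis n => put p t e.1 e.2) (colourTensor a b f)) c =
      if put p (fun r => (t r).2) a b = c then insertPoly p (fun r => (t r).1) f else 0 := by
  induction f using laurent_induction with
  | zero => simp [colourTensor, part_zero]
  | add f g hf hg =>
    rw [colourTensor, AddMonoidAlgebra.coeff_add, Finsupp.mapDomain_add, Finsupp.mapDomain_add,
      part_add, Pi.add_apply]
    rw [colourTensor] at hf hg
    rw [hf, hg, map_add]
    split_ifs <;> simp
  | smul r x y =>
    rw [colourTensor, AddMonoidAlgebra.coeff_smul, Finsupp.mapDomain_smul, Finsupp.mapDomain_smul,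
      part_smul, map_smul, insertPoly_mon, Pi.smul_apply, mon, AddMonoidAlgebra.coeff_single,
      Finsupp.mapDomain_single, Finsupp.mapDomain_single, part_single]
    simp only
    rw [comp_put p t (x, a) (y, b) Prod.snd, comp_put p t (x, a) (y, b) Prod.fst]
    split_ifs <;> simp

theorem heckeT_single (q : k) (p : ℕ) (t : PureTensor n) :
    heckeT q p (Finsupp.single t 1) =
      Finsupp.mapDomain (fun e : Basis n × Basis n => put p t e.1 e.2)
        (heckeTwo q (t p) (t (p + 1))) := by
  rw [heckeT, Finsupp.linearCombination_single, one_smul]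
  rfl

theorem permField_put (p : ℕ) (d : ℕ → ℤ) (a b : ℤ) :
    permField k (adj p) (monomialOf k (put p d a b)) = monomialOf k (put p d b a) := by
  rw [permField_monomialOf, show (adj p)⁻¹ = adj p from Equiv.swap_inv _ _, put_comp_adj]

theorem part_heckeT_single (q : k) (p : ℕ) (t : PureTensor n) :
    part (heckeT q p (Finsupp.single t 1)) = heckeOp q p (part (Finsupp.single t 1)) := by
  classical
  ext c
  set L : ((Basis n × Basis n) →₀ k) →ₗ[k] DegField k :=
    LinearMap.proj c ∘ₗ partₗ ∘ₗ Finsupp.lmapDomain k k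
      (fun e : Basis n × Basis n => put p t e.1 e.2) with hL
  have hLc : ∀ a b f, L (colourTensor a b f) =
      if put p (fun r => (t r).2) a b = c then insertPoly p (fun r => (t r).1) f else 0 :=
    fun a b f => part_insert_colourTensor p t a b f c
  rw [heckeT_single, show part (Finsupp.mapDomain _ (heckeTwo q (t p) (t (p + 1)))) c =
    L (heckeTwo q (t p) (t (p + 1))) from rfl]
  rw [heckeOp, heckeFun]
  simp only [part_single]
  have hput : (fun r => (t r).1) = put p (fun r => (t r).1) (t p).1 (t (p + 1)).1 :=
    (put_self p fun r => (t r).1).symm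
  simp only [put_eq_iff]
  have hne := var_sub_ne_zero (k := k) p
  have hLc' : ∀ a b f, L (colourTensor a b f) =
      if c p = a ∧ c (p + 1) = b ∧ (∀ r, r ≠ p → r ≠ p + 1 → (t r).2 = c r) then
        insertPoly p (fun r => (t r).1) f else 0 := by
    intro a b f
    rw [hLc]
    refine if_congr ?_ rfl rfl
    rw [eq_comm, put_eq_iff]
    simp only [eq_comm]
  by_cases hag : ∀ r, r ≠ p → r ≠ p + 1 → (t r).2 = c r
  · rw [hput]
    generalize (fun r => (t r).1) = d at *
    simp only [iff_true_intro hag, and_true] at hLc' ⊢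
    clear_value L
    generalize t p = u at *
    generalize t (p + 1) = w at *
    generalize c p = α at *
    generalize c (p + 1) = β at *
    obtain ⟨u1, u2⟩ := u
    obtain ⟨w1, w2⟩ := w
    simp only [heckeTwo, swapCoeff, idCoeff]
    have hx : ∀ a b, monomialOf k (put p d (a + 1) b) = var k p * monomialOf k (put p d a b) :=
      fun a b => by rw [add_comm, (monomialOf_put_add p d a b).1]
    have hy : ∀ a b, monomialOf k (put p d a (b + 1)) = var k (p + 1) * monomialOf k (put p d a b) :=
      fun a b => by rw [add_comm, (monomialOf_put_add p d a b).2]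
    rcases lt_trichotomy u2 w2 with h | h | h
    · simp only [h, if_true, map_sub, map_neg, map_smul, hLc', insertPoly_mon, insertPoly_divDiff,
        hx, hy, Algebra.smul_def, map_pow, map_one]
      by_cases h1 : α = u2 ∧ β = w2
      · obtain ⟨rfl, rfl⟩ := h1
        simp only [h, h.ne, h.ne', if_true, if_false, and_self, and_false, permField_put, map_zero]
        field_simp
        ring
      by_cases h2 : α = w2 ∧ β = u2
      · obtain ⟨rfl, rfl⟩ := h2
        simp [h.ne, h.ne', h.not_gt, permField_put]
      · have h1' : ¬(u2 = α ∧ w2 = β) := fun e => h1 ⟨e.1.symm, e.2.symm⟩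
        have h2' : ¬(u2 = β ∧ w2 = α) := fun e => h2 ⟨e.2.symm, e.1.symm⟩
        simp [h1, h2, h1', h2']
    · subst h
      simp only [lt_irrefl, if_true, if_false, map_sub, map_neg, map_smul, hLc', insertPoly_mon,
        insertPoly_left_mul, insertPoly_divDiff, Algebra.smul_def, map_pow, map_one]
      by_cases h1 : α = u2 ∧ β = u2
      · obtain ⟨rfl, rfl⟩ := h1
        simp only [lt_irrefl, if_true, if_false, and_self, permField_put, insertPoly_left_mul,
          insertPoly_divDiff]
        field_simp
        ring
      · have h1' : ¬(u2 = α ∧ u2 = β) := fun e => h1 ⟨e.1.symm, e.2.symm⟩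
        have h2' : ¬(u2 = β ∧ u2 = α) := fun e => h1 ⟨e.2.symm, e.1.symm⟩
        simp [h1, h1', h2']
    · simp only [h.not_gt, h.ne', if_false, map_sub, map_neg, map_smul, hLc', insertPoly_mon,
        insertPoly_left_mul, insertPoly_divDiff, Algebra.smul_def, map_pow, map_one]
      by_cases h1 : α = u2 ∧ β = w2
      · obtain ⟨rfl, rfl⟩ := h1
        simp only [h.not_gt, h.ne, h.ne', if_true, if_false, and_self, and_false, permField_put,
          map_zero]
        field_simp
        ring
      by_cases h2 : α = w2 ∧ β = u2
      · obtain ⟨rfl, rfl⟩ := h2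
        simp [h.ne, h.ne', permField_put]
      · have h1' : ¬(u2 = α ∧ w2 = β) := fun e => h1 ⟨e.1.symm, e.2.symm⟩
        have h2' : ¬(u2 = β ∧ w2 = α) := fun e => h2 ⟨e.2.symm, e.1.symm⟩
        simp [h1, h2, h1', h2']
  · simp only [iff_false_intro hag, and_false, if_false] at hLc' ⊢
    simp only [heckeTwo]
    split_ifs <;> simp [hLc']

theorem heckeOp_add (q : k) (p : ℕ) (Φ Ψ : (ℕ → Fin n) → DegField k) :
    heckeOp q p (Φ + Ψ) = heckeOp q p Φ + heckeOp q p Ψ := by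
  ext c
  simp only [heckeOp, heckeFun, Pi.add_apply, map_add]
  ring

theorem heckeOp_smul (q : k) (p : ℕ) (a : k) (Φ : (ℕ → Fin n) → DegField k) :
    heckeOp q p (a • Φ) = a • heckeOp q p Φ := by
  ext c
  simp only [heckeOp, heckeFun, Pi.smul_apply, permField_smul, smul_add, mul_smul_comm]

/-- A linear map `A` that corresponds to `B` under `part` on pure tensors does so on all their linear
combinations. -/
theorem part_comp_eq {A : FinVector k n →ₗ[k] FinVector k n}
    {B : ((ℕ → Fin n) → DegField k) → (ℕ → Fin n) → DegField k}
    (add : ∀ Φ Ψ, B (Φ + Ψ) = B Φ + B Ψ) (smul : ∀ (a : k) Φ, B (a • Φ) = a • B Φ)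
    (h : ∀ t : PureTensor n, part (A (Finsupp.single t 1)) = B (part (Finsupp.single t 1)))
    (x : FinVector k n) : part (A x) = B (part x) := by
  induction x using Finsupp.induction_linear with
  | zero =>
    have h0 := smul 0 0
    rw [zero_smul, zero_smul] at h0
    rw [map_zero, part_zero, h0]
  | add x y hx hy => rw [map_add, part_add, part_add, add, hx, hy]
  | single t r =>
    have : (Finsupp.single t r : FinVector k n) = r • Finsupp.single t 1 := by simp
    rw [this, map_smul, part_smul, part_smul, smul, h]

theorem part_heckeT (q : k) (p : ℕ) (x : FinVector k n) :
    part (heckeT q p x) = heckeOp q p (part x) :=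
  part_comp_eq (heckeOp_add q p) (heckeOp_smul q p) (part_heckeT_single q p) x

theorem adj_field_involutive (p : ℕ) (f : DegField k) :
    permField k (adj p) (permField k (adj p) f) = f := by
  rw [← permField_mul, adj_mul_self, permField_one]

theorem heckeT_braid (q : k) (p : ℕ) (x : FinVector k n) :
    heckeT q p (heckeT q (p + 1) (heckeT q p x)) =
      heckeT q (p + 1) (heckeT q p (heckeT q (p + 1) x)) := by
  apply part_injective
  simp only [part_heckeT]
  ext c
  generalize part x = Φ
  have key := heckeFun_braid (q := algebraMap k (DegField k) q) (x := var k p)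
    (y := var k (p + 1)) (z := var k (p + 1 + 1)) (var_injective.ne (by omega))
    (var_injective.ne (by omega)) (var_injective.ne (by omega))
    (s := permField k (adj p)) (t := permField k (adj (p + 1)))
    (permField_algebraMap_base _ _) (permField_algebraMap_base _ _)
    (by rw [permField_var, adj_apply_left]) (by rw [permField_var, adj_apply_right])
    (by rw [permField_var, adj_apply_of_ne (by omega) (by omega)])
    (by rw [permField_var, adj_apply_of_ne (by omega) (by omega)])
    (by rw [permField_var, adj_apply_left]) (by rw [permField_var, adj_apply_right])
    (adj_field_involutive p) (adj_field_involutive (p + 1))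
    (fun f => by simp only [← permField_mul, ← mul_assoc]; rw [adj_braid])
    (fun a b d => Φ (Function.update (put p c a b) (p + 1 + 1) d)) (c p) (c (p + 1)) (c (p + 1 + 1))
  have e1 : ∀ a b x y u v, put p (put (p + 1) (put p c a b) x y) u v =
      Function.update (put p c u v) (p + 1 + 1) y := by
    intro a b x y u v
    ext r
    simp only [put, Function.update_apply]
    split_ifs <;> first | rfl | omega
  have e2 : ∀ a b x y u v, put (p + 1) (put p (put (p + 1) c a b) x y) u v =
      Function.update (put p c x u) (p + 1 + 1) v := by
    intro a b x y u v
    ext r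
    simp only [put, Function.update_apply]
    split_ifs <;> rfl
  have e3 : ∀ (f : ℕ → Fin n) a b, put (p + 1) f a b p = f p :=
    fun f a b => put_of_ne _ _ _ _ (by omega) (by omega)
  have e4 : ∀ (f : ℕ → Fin n) a b, put p f a b (p + 1 + 1) = f (p + 1 + 1) :=
    fun f a b => put_of_ne _ _ _ _ (by omega) (by omega)
  simp only [heckeOp, e1, e2, e3, e4, put_left, put_right]
  exact key

theorem heckeT_far (q : k) {p r : ℕ} (h : p + 1 < r) (x : FinVector k n) :
    heckeT q p (heckeT q r x) = heckeT q r (heckeT q p x) := by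
  apply part_injective
  simp only [part_heckeT]
  ext c
  generalize part x = Φ
  have e1 : ∀ a b, put p c a b r = c r := fun a b => put_of_ne _ _ _ _ (by omega) (by omega)
  have e2 : ∀ a b, put p c a b (r + 1) = c (r + 1) :=
    fun a b => put_of_ne _ _ _ _ (by omega) (by omega)
  have e3 : ∀ a b, put r c a b p = c p := fun a b => put_of_ne _ _ _ _ (by omega) (by omega)
  have e4 : ∀ a b, put r c a b (p + 1) = c (p + 1) :=
    fun a b => put_of_ne _ _ _ _ (by omega) (by omega)
  have e5 : ∀ x y a b, put p (put r c x y) a b = put r (put p c a b) x y :=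
    fun x y a b => put_comm_far _ _ _ h _ _
  have hpr : ∀ f, permField k (adj p) (permField k (adj r) f) =
      permField k (adj r) (permField k (adj p) f) := fun f => by
    rw [← permField_mul, adj_comm h, permField_mul]
  simp only [heckeOp, heckeFun, idCoeff, swapCoeff, e1, e2, e3, e4, map_add, map_mul, map_sub,
    map_div₀, map_pow, map_one, permField_var, permField_algebraMap_base, adj_apply_of_ne
    (p := p) (r := r) (by omega) (by omega), adj_apply_of_ne (p := p) (r := r + 1) (by omega)
    (by omega), adj_apply_of_ne (p := r) (r := p) (by omega) (by omega),
    adj_apply_of_ne (p := r) (r := p + 1) (by omega) (by omega), hpr, apply_ite (permField k _),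
    map_neg, map_zero, e5]
  ring

/-! ### The Hecke action of permutations -/

theorem heckeWord_eq_of_reduced (q : k) (x : FinVector k n) {l l' : List ℕ} {σ : Equiv.Perm ℕ}
    (h : IsReducedWord l σ) (h' : IsReducedWord l' σ) : heckeWord q l x = heckeWord q l' x := by
  rw [isReducedWord_iff] at h h'
  exact foldl_eq_of_reduced (fun p y => heckeT q p y) (fun p r x hpr => heckeT_far q hpr x)
    (fun p x => heckeT_braid q p x) x (h.1.trans h'.1.symm) (h.1.symm ▸ h.2) (h.1.symm ▸ h'.2)

theorem heckeTσ_eq_heckeWord (q : k) (x : FinVector k n) {l : List ℕ} {σ : SInf}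
    (h : IsReducedWord l σ) : heckeTσ q σ x = heckeWord q l x :=
  heckeWord_eq_of_reduced q x (reducedWord_spec σ) h

/-- The adjacent transposition of `p` and `p + 1` as an element of `SInf`. -/
def adjS (p : ℕ) : SInf := ⟨adj p, adj_mem p⟩

theorem heckeTσ_one (q : k) (x : FinVector k n) : heckeTσ q 1 x = x := by
  rw [heckeTσ_eq_heckeWord q x (l := []) (by rw [isReducedWord_iff]; simp [wordProd, invNum_one])]
  rfl

theorem heckeTσ_mul_adjS (q : k) (x : FinVector k n) {σ : SInf} {p : ℕ}
    (h : (σ : Equiv.Perm ℕ) p < (σ : Equiv.Perm ℕ) (p + 1)) :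
    heckeTσ q (σ * adjS p) x = heckeT q p (heckeTσ q σ x) := by
  have h1 := isReducedWord_iff.1 (reducedWord_spec σ)
  rw [heckeTσ_eq_heckeWord q x (l := reducedWord σ ++ [p])]
  · simp [heckeWord, heckeTσ]
  · rw [isReducedWord_iff]
    constructor
    · rw [wordProd_append, wordProd_singleton, h1.1]
      rfl
    · rw [List.length_append, h1.2]
      exact (invNum_mul_adj_of_lt σ.2 h).symm

theorem heckeTσ_adjS_mul (q : k) (x : FinVector k n) {σ : SInf} {p : ℕ}
    (h : (σ : Equiv.Perm ℕ)⁻¹ p < (σ : Equiv.Perm ℕ)⁻¹ (p + 1)) :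
    heckeTσ q (adjS p * σ) x = heckeTσ q σ (heckeT q p x) := by
  have h1 := isReducedWord_iff.1 (reducedWord_spec σ)
  rw [heckeTσ_eq_heckeWord q x (l := p :: reducedWord σ)]
  · simp [heckeWord, heckeTσ]
  · rw [isReducedWord_iff]
    constructor
    · rw [show p :: reducedWord σ = [p] ++ reducedWord σ from rfl, wordProd_append,
        wordProd_singleton, h1.1]
      rfl
    · rw [List.length_cons, h1.2]
      exact (invNum_adj_mul_of_lt σ.2 h).symm

theorem heckeWord_linear (q : k) (l : List ℕ) : ∃ A : FinVector k n →ₗ[k] FinVector k n,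
    ∀ x, heckeWord q l x = A x := by
  induction l using List.reverseRecOn with
  | nil => exact ⟨LinearMap.id, fun x => rfl⟩
  | append_singleton l p ih =>
    obtain ⟨A, hA⟩ := ih
    refine ⟨heckeT q p ∘ₗ A, fun x => ?_⟩
    rw [LinearMap.comp_apply, ← hA]
    simp [heckeWord]

end QWedge
namespace QWedge

/-! ### Truncated raising operators -/

variable {k : Type*} [Field k] {n : ℕ}

theorem val_sub_one [NeZero n] (hn : 2 ≤ n) (j : Fin n) :
    ((j - 1 : Fin n) : ℕ) = if j = 0 then n - 1 else (j : ℕ) - 1 := by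
  have h1 : ((1 : Fin n) : ℕ) = 1 := by rw [Fin.val_one', Nat.mod_eq_of_lt (by omega)]
  rw [Fin.sub_def]
  simp only [h1, Fin.ext_iff, Fin.val_zero]
  have := j.2
  split_ifs with h
  · rw [h, add_zero, Nat.mod_eq_of_lt (by omega)]
  · rw [show n - 1 + (j : ℕ) = (j - 1) + n by omega, Nat.add_mod_right, Nat.mod_eq_of_lt (by omega)]

theorem sub_one_ne [NeZero n] (hn : 2 ≤ n) (j : Fin n) : j - 1 ≠ j := fun h => by
  have h1 := val_sub_one hn j
  rw [h] at h1
  have := j.2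
  split_ifs at h1 with h0
  · simp only [h0, Fin.val_zero] at h1
    omega
  · have : (j : ℕ) ≠ 0 := fun e => h0 (Fin.ext (by simpa using e))
    omega

/-- The summand of the coproduct of `E_j` with `E_j` in the factor of index `p`, truncated to the
factors of index below `M`. -/
noncomputable def raiseAt (q : k) [NeZero n] (j : Fin n) (M p : ℕ) (u : PureTensor n) :
    FinVector k n :=
  if (u p).2 = j then
    Finsupp.single (Function.update u p (raise j (u p).1))
      (∏ r ∈ Finset.Ioo p M, colourFactor q (j - 1) j (u r).2)
  else 0

/-- The generator `E_j` acting on the tensor product of the factors of index below `M`. -/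
noncomputable def raiseTrunc (q : k) [NeZero n] (j : Fin n) (M : ℕ) :
    FinVector k n →ₗ[k] FinVector k n :=
  Finsupp.linearCombination k fun u => ∑ p ∈ Finset.range M, raiseAt q j M p u

/-- What `E_j` multiplies by in the factor of index `p`: the variable if `j = 0`, and `1` otherwise. -/
noncomputable def raiseVar (k : Type*) [Field k] [NeZero n] (j : Fin n) (p : ℕ) : DegField k :=
  if j = 0 then var k p else 1

/-- `raiseAt` on families of rational functions indexed by the colours. -/
noncomputable def raiseOpAt (q : k) [NeZero n] (j : Fin n) (M p : ℕ)
    (Φ : (ℕ → Fin n) → DegField k) (c : ℕ → Fin n) : DegField k :=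
  if c p = j - 1 then
    raiseVar k j p *
      (∏ r ∈ Finset.Ioo p M, colourFactor (algebraMap k (DegField k) q) (j - 1) j (c r)) *
      Φ (Function.update c p j)
  else 0

/-- `raiseTrunc` on families of rational functions indexed by the colours. -/
noncomputable def raiseOp (q : k) [NeZero n] (j : Fin n) (M : ℕ)
    (Φ : (ℕ → Fin n) → DegField k) : (ℕ → Fin n) → DegField k :=
  ∑ p ∈ Finset.range M, raiseOpAt q j M p Φ

theorem colourFactor_algebraMap (q : k) (i j c : Fin n) :
    colourFactor (algebraMap k (DegField k) q) i j c =
      algebraMap k (DegField k) (colourFactor q i j c) := by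
  unfold colourFactor
  split_ifs <;> simp

theorem monomialOf_update_raise [NeZero n] (j : Fin n) (p : ℕ) (t : PureTensor n) :
    monomialOf k (fun r => (Function.update t p (raise j (t p).1) r).1) =
      raiseVar k j p * monomialOf k fun r => (t r).1 := by
  unfold raiseVar raise
  split_ifs with h
  · rw [var, monomialOf_mul]
    congr 1
    ext r
    by_cases hr : r = p
    · subst hr
      simp [add_comm]
    · simp [hr]
  · rw [one_mul]
    congr 1
    ext r
    by_cases hr : r = p
    · subst hr
      simp
    · simp [hr]

theorem part_raiseAt [NeZero n] (q : k) (j : Fin n) (M p : ℕ) (t : PureTensor n) :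
    part (raiseAt q j M p t) = raiseOpAt q j M p (part (Finsupp.single t (1 : k))) := by
  classical
  ext c
  have hsingle : ∀ (u : PureTensor n) (a : k), part (Finsupp.single u a) c =
      algebraMap k (DegField k) a * part (Finsupp.single u (1 : k)) c := by
    intro u a
    rw [← Algebra.smul_def, ← Pi.smul_apply, ← part_smul]
    simp
  by_cases h : (t p).2 = j ∧ (fun r => (Function.update t p (raise j (t p).1) r).2) = c
  · obtain ⟨h1, rfl⟩ := h
    have h2 : (fun r => (t r).2) =
        Function.update (fun r => (Function.update t p (raise j (t p).1) r).2) p j := by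
      ext r
      by_cases hr : r = p
      · subst hr
        simp [h1]
      · simp [hr]
    rw [raiseAt, if_pos h1, raiseOpAt, if_pos (by simp [raise]), hsingle, part_single, if_pos rfl,
      part_single, if_pos h2, monomialOf_update_raise, map_prod]
    have h3 : ∏ r ∈ Finset.Ioo p M, colourFactor (algebraMap k (DegField k) q) (j - 1) j
          (Function.update t p (raise j (t p).1) r).2 =
        ∏ r ∈ Finset.Ioo p M, algebraMap k (DegField k) (colourFactor q (j - 1) j (t r).2) := by
      refine Finset.prod_congr rfl fun r hr => ?_
      rw [Function.update_of_ne (by have := (Finset.mem_Ioo.1 hr).1; omega),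
        colourFactor_algebraMap]
    rw [h3]
    ring
  · have lhs : part (raiseAt q j M p t) c = 0 := by
      rw [raiseAt]
      split_ifs with h1
      · rw [hsingle, part_single, if_neg (fun e => h ⟨h1, e⟩), mul_zero]
      · simp [part_zero]
    rw [lhs, raiseOpAt]
    split_ifs with h1
    · rw [part_single, if_neg, mul_zero]
      intro e
      apply h
      constructor
      · simpa using congrFun e p
      · ext r
        by_cases hr : r = p
        · subst hr
          simp [raise, h1]
        · have := congrFun e r
          simp only [Function.update_of_ne hr] at this
          simp [hr, this]
    · rfl

theorem part_raiseTrunc [NeZero n] (q : k) (j : Fin n) (M : ℕ) (x : FinVector k n) :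
    part (raiseTrunc q j M x) = raiseOp q j M (part x) := by
  refine part_comp_eq ?_ ?_ ?_ x
  · intro Φ Ψ
    rw [raiseOp, raiseOp, raiseOp, ← Finset.sum_add_distrib]
    refine Finset.sum_congr rfl fun p _ => ?_
    ext c
    simp only [raiseOpAt, Pi.add_apply]
    split_ifs <;> ring
  · intro a Φ
    rw [raiseOp, raiseOp, Finset.smul_sum]
    refine Finset.sum_congr rfl fun p _ => ?_
    ext c
    simp only [raiseOpAt, Pi.smul_apply]
    split_ifs
    · rw [mul_smul_comm]
    · rw [smul_zero]
  · intro t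
    rw [raiseTrunc, Finsupp.linearCombination_single, one_smul, raiseOp]
    simp only [← part_raiseAt]
    exact map_sum partₗ _ _

theorem heckeFun_mul {K α : Type*} [Field K] [LinearOrder α] {q : K} {s : K →+* K} {x y C : K}
    (hC : s C = C) (F : α → α → K) (a b : α) :
    heckeFun q s x y (fun a b => C * F a b) a b = C * heckeFun q s x y F a b := by
  simp only [heckeFun, map_mul, hC]
  ring

theorem permField_colourFactor (σ : Equiv.Perm ℕ) (q : k) (i j c : Fin n) :
    permField k σ (colourFactor (algebraMap k (DegField k) q) i j c) =
      colourFactor (algebraMap k (DegField k) q) i j c := by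
  rw [colourFactor_algebraMap, permField_algebraMap_base]

theorem prod_put_swap {β K : Type*} [CommMonoid K] (f : β → K) (c : ℕ → β) {r p M : ℕ}
    (hr : r + 1 < M) (h1 : p ≠ r) (h2 : p ≠ r + 1) :
    ∏ i ∈ Finset.Ioo p M, f (put r c (c (r + 1)) (c r) i) = ∏ i ∈ Finset.Ioo p M, f (c i) := by
  refine Finset.prod_equiv (adj r) ?_ ?_
  · intro i
    simp only [Finset.mem_Ioo, adj, Equiv.swap_apply_def]
    split_ifs <;> omega
  · intro i _
    rw [← put_comp_adj, put_self]

theorem put_update_comm {β : Type*} (c : ℕ → β) {r p : ℕ} (h1 : p ≠ r) (h2 : p ≠ r + 1)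
    (a b x : β) : Function.update (put r c a b) p x = put r (Function.update c p x) a b := by
  unfold put
  rw [Function.update_comm h1, Function.update_comm h2]

/-- The summands of the coproduct with `E_j` away from the two factors of a Hecke generator commute
with it one by one. -/
theorem heckeOp_raiseOpAt [NeZero n] (q : k) (j : Fin n) {M r p : ℕ} (hr : r + 1 < M)
    (h1 : p ≠ r) (h2 : p ≠ r + 1) (Φ : (ℕ → Fin n) → DegField k) :
    heckeOp q r (raiseOpAt q j M p Φ) = raiseOpAt q j M p (heckeOp q r Φ) := by
  ext c
  have hC : permField k (adj r) (raiseVar k j p * ∏ i ∈ Finset.Ioo p M,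
        colourFactor (algebraMap k (DegField k) q) (j - 1) j (c i)) =
      raiseVar k j p * ∏ i ∈ Finset.Ioo p M,
        colourFactor (algebraMap k (DegField k) q) (j - 1) j (c i) := by
    rw [map_mul, map_prod]
    simp only [permField_colourFactor]
    congr 1
    unfold raiseVar
    split_ifs
    · rw [permField_var, adj_apply_of_ne h1 h2]
    · exact map_one _
  have hp : ∀ a b, put r c a b p = c p := fun a b => put_of_ne _ _ _ _ h1 h2
  have hself : put r (Function.update c p j) (c r) (c (r + 1)) = Function.update c p j := by
    have := put_self r (Function.update c p j)
    rwa [Function.update_of_ne h1.symm, Function.update_of_ne h2.symm] at this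
  by_cases hc : c p = j - 1
  · simp only [raiseOpAt, heckeOp, heckeFun, hp, put_self, prod_put_swap _ _ hr h1 h2,
      put_update_comm _ h1 h2, Function.update_of_ne h1.symm, Function.update_of_ne h2.symm, hc,
      if_true, map_mul _ (raiseVar k j p * _) _, hC, hself]
    ring
  · simp [raiseOpAt, heckeOp, heckeFun, hp, hc]

/-- The two summands with `E_j` in one of the factors of a Hecke generator commute with it only
together. -/
theorem heckeOp_raiseOpAt_add [NeZero n] (hn : 2 ≤ n) {q : k} (hq : q ≠ 0) (j : Fin n) {M r : ℕ}
    (hr : r + 1 < M) (Φ : (ℕ → Fin n) → DegField k) :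
    heckeOp q r (raiseOpAt q j M r Φ + raiseOpAt q j M (r + 1) Φ) =
      raiseOpAt q j M r (heckeOp q r Φ) + raiseOpAt q j M (r + 1) (heckeOp q r Φ) := by
  ext c
  set Q := algebraMap k (DegField k) q with hQ
  set W := ∏ i ∈ Finset.Ioo (r + 1) M, colourFactor Q (j - 1) j (c i) with hW
  have key : ∀ Ψ : (ℕ → Fin n) → DegField k, ∀ a b,
      (raiseOpAt q j M r Ψ + raiseOpAt q j M (r + 1) Ψ) (put r c a b) =
      W * raiseFun Q (j - 1) j (raiseVar k j r) (raiseVar k j (r + 1))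
        (fun a b => Ψ (put r c a b)) a b := by
    intro Ψ a b
    have e1 : Finset.Ioo r M = insert (r + 1) (Finset.Ioo (r + 1) M) := by
      ext i
      simp only [Finset.mem_Ioo, Finset.mem_insert]
      omega
    have e2 : ∏ i ∈ Finset.Ioo (r + 1) M, colourFactor Q (j - 1) j (put r c a b i) = W := by
      refine Finset.prod_congr rfl fun i hi => ?_
      have := (Finset.mem_Ioo.1 hi).1
      rw [put_of_ne _ _ _ _ (by omega) (by omega)]
    have e3 : Function.update (put r c a b) r j = put r c j b := by
      rw [put_eq_iff]
      exact ⟨by simp, by simp, fun i h h' => by simp [h, put_of_ne, h']⟩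
    have e4 : Function.update (put r c a b) (r + 1) j = put r c a j := by
      rw [put_eq_iff]
      exact ⟨by simp, by simp, fun i h h' => by simp [h, put_of_ne, h']⟩
    simp only [Pi.add_apply, raiseOpAt, raiseFun, e1, ← hQ]
    rw [Finset.prod_insert (by simp), e2, e3, e4, put_left, put_right]
    split_ifs <;> ring
  have hWs : permField k (adj r) W = W := by
    rw [hW, map_prod]
    simp only [hQ, permField_colourFactor]
  have key' := key (heckeOp q r Φ) (c r) (c (r + 1))
  rw [put_self] at key'
  rw [key', heckeOp]
  simp only [key]
  rw [heckeFun_mul hWs, heckeFun_raiseFun (by simpa [hQ] using hq) (var_injective.ne (by omega))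
    (permField_algebraMap_base _ _)]
  · congr 2
    ext a b
    simp only [heckeOp, put_left, put_right, put_put]
  · unfold raiseVar
    split_ifs
    · rw [permField_var, adj_apply_left]
    · exact map_one _
  · unfold raiseVar
    split_ifs
    · rw [permField_var, adj_apply_right]
    · exact map_one _
  · rw [permField_var, adj_apply_left]
  · rw [permField_var, adj_apply_right]
  · have hv := val_sub_one hn j
    by_cases hj : j = 0
    · left
      subst hj
      rw [if_pos rfl] at hv
      refine ⟨if_pos rfl, if_pos rfl, ?_, fun d h1 h2 => ?_⟩
      · rw [Fin.lt_def, hv, Fin.val_zero]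
        omega
      · rw [ne_eq, Fin.ext_iff, hv] at h1
        rw [ne_eq, Fin.ext_iff, Fin.val_zero] at h2
        rw [Fin.lt_def, Fin.lt_def, hv, Fin.val_zero]
        omega
    · right
      rw [if_neg hj] at hv
      have hj' : (j : ℕ) ≠ 0 := fun e => hj (Fin.ext (by rw [e, Fin.val_zero]))
      refine ⟨if_neg hj, if_neg hj, ?_, fun d h1 h2 => ?_⟩
      · rw [Fin.lt_def, hv]
        omega
      · rw [ne_eq, Fin.ext_iff, hv] at h1
        rw [ne_eq, Fin.ext_iff] at h2
        rw [Fin.lt_def, Fin.lt_def, Fin.lt_def, Fin.lt_def, hv]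
        omega

theorem heckeOp_raiseOp [NeZero n] (hn : 2 ≤ n) {q : k} (hq : q ≠ 0) (j : Fin n) {M r : ℕ}
    (hr : r + 1 < M) (Φ : (ℕ → Fin n) → DegField k) :
    heckeOp q r (raiseOp q j M Φ) = raiseOp q j M (heckeOp q r Φ) := by
  have split : ∀ f : ℕ → (ℕ → Fin n) → DegField k, ∑ p ∈ Finset.range M, f p =
      (f r + f (r + 1)) + ∑ p ∈ (Finset.range M).filter fun p => p ≠ r ∧ p ≠ r + 1, f p := by
    intro f
    rw [← Finset.sum_pair (by omega : r ≠ r + 1), ← Finset.sum_union]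
    · refine Finset.sum_congr ?_ fun _ _ => rfl
      ext i
      simp only [Finset.mem_range, Finset.mem_union, Finset.mem_insert, Finset.mem_singleton,
        Finset.mem_filter]
      omega
    · rw [Finset.disjoint_left]
      intro i
      simp only [Finset.mem_insert, Finset.mem_singleton, Finset.mem_filter]
      omega
  let H : ((ℕ → Fin n) → DegField k) →+ ((ℕ → Fin n) → DegField k) :=
    { toFun := heckeOp q r
      map_zero' := by simpa using heckeOp_smul q r 0 (0 : (ℕ → Fin n) → DegField k)
      map_add' := heckeOp_add q r }
  have hH : ∀ Ψ, heckeOp q r Ψ = H Ψ := fun _ => rfl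
  rw [raiseOp, raiseOp, split, split, ← heckeOp_raiseOpAt_add hn hq j hr, hH, map_add, map_sum]
  congr 1
  refine Finset.sum_congr rfl fun p hp => ?_
  have := (Finset.mem_filter.1 hp).2
  exact heckeOp_raiseOpAt q j hr this.1 this.2 Φ

theorem heckeT_raiseTrunc [NeZero n] (hn : 2 ≤ n) {q : k} (hq : q ≠ 0) (j : Fin n) {M r : ℕ}
    (hr : r + 1 < M) (x : FinVector k n) :
    heckeT q r (raiseTrunc q j M x) = raiseTrunc q j M (heckeT q r x) := by
  apply part_injective
  rw [part_heckeT, part_raiseTrunc, part_raiseTrunc, part_heckeT, heckeOp_raiseOp hn hq j hr]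

end QWedge
namespace QWedge

/-! ### Supports of the Hecke action -/

variable {k : Type*} [Field k] {n : ℕ}

/-- The position of a basis vector in the sequence
`..., z^d v_n, ..., z^d v_1, z^{d+1} v_n, ..., z^{d+1} v_1, ...`. -/
def pos (b : Basis n) : ℤ := n * b.1 + (n - 1 - (b.2 : ℕ))

theorem pos_lt_iff {b b' : Basis n} : pos b < pos b' ↔ b.1 < b'.1 ∨ (b.1 = b'.1 ∧ b'.2 < b.2) := by
  obtain ⟨d, c⟩ := b
  obtain ⟨d', c'⟩ := b'
  simp only [pos, Fin.lt_def]
  have h1 := c.2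
  have h2 := c'.2
  rcases lt_trichotomy d d' with h | rfl | h
  · have : (n : ℤ) * (d + 1) ≤ n * d' := mul_le_mul_of_nonneg_left (by omega) (by omega)
    rw [mul_add] at this
    constructor
    · exact fun _ => Or.inl h
    · intro _
      omega
  · constructor
    · intro h
      exact Or.inr ⟨rfl, by omega⟩
    · rintro (h | ⟨_, h⟩) <;> omega
  · have : (n : ℤ) * (d' + 1) ≤ n * d := mul_le_mul_of_nonneg_left (by omega) (by omega)
    rw [mul_add] at this
    constructor
    · intro h
      omega
    · rintro (h | ⟨_, h⟩) <;> omega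

theorem pos_le_iff {b b' : Basis n} : pos b ≤ pos b' ↔ b.1 < b'.1 ∨ (b.1 = b'.1 ∧ b'.2 ≤ b.2) := by
  rw [← not_lt, pos_lt_iff]
  simp only [Fin.lt_def, Fin.le_def]
  omega

theorem pos_injective : Function.Injective (pos : Basis n → ℤ) := fun b b' h => by
  have h1 := (pos_le_iff (b := b) (b' := b')).1 h.le
  have h2 := (pos_le_iff (b := b') (b' := b)).1 h.ge
  rw [Fin.le_def] at h1 h2
  refine Prod.ext (by omega) (Fin.ext (by omega))

theorem colour_ne_of_pos (hn : 2 ≤ n) {b b' : Basis n} (h : pos b + 1 = pos b') : b.2 ≠ b'.2 := by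
  obtain ⟨d, c⟩ := b
  obtain ⟨d', c'⟩ := b'
  rintro rfl
  simp only [pos] at h
  have h1 : (n : ℤ) * (d' - d) = 1 := by rw [mul_sub]; omega
  have := Int.eq_one_or_neg_one_of_mul_eq_one h1
  omega

theorem colourTensor_apply_ne_zero {a b : Fin n} {f : Laurent₂ k} {e : Basis n × Basis n}
    (h : colourTensor a b f e ≠ 0) :
    e.1.2 = a ∧ e.2.2 = b ∧ f.coeff (e.1.1, e.2.1) ≠ 0 := by
  classical
  have h1 := Finsupp.mapDomain_support (Finsupp.mem_support_iff.2 h)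
  obtain ⟨x, hx, rfl⟩ := Finset.mem_image.1 h1
  exact ⟨rfl, rfl, Finsupp.mem_support_iff.1 hx⟩

theorem sum_mon_coeff_ne_zero {a b x y : ℤ} {m : ℕ}
    (h : (∑ l ∈ Finset.range m, mon k (a + l) (b - 1 - l)).coeff (x, y) ≠ 0) :
    ∃ l : ℕ, l < m ∧ x = a + l ∧ y = b - 1 - l := by
  rw [AddMonoidAlgebra.coeff_sum, Finsupp.finsetSum_apply] at h
  obtain ⟨l, hl, h1⟩ := Finset.exists_ne_zero_of_sum_ne_zero h
  refine ⟨l, Finset.mem_range.1 hl, ?_⟩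
  rw [mon, AddMonoidAlgebra.coeff_single, Finsupp.single_apply_ne_zero] at h1
  simpa using h1.1

theorem divDiff_coeff_ne_zero {a b x y : ℤ} (h : (divDiff k a b).coeff (x, y) ≠ 0) :
    (a ≤ x ∧ x < b ∧ a ≤ y ∧ y < b) ∨ (b ≤ x ∧ x < a ∧ b ≤ y ∧ y < a) := by
  rw [divDiff, AddMonoidAlgebra.coeff_sub, Finsupp.sub_apply] at h
  by_cases h1 : (∑ l ∈ Finset.range (b - a).toNat, mon k (a + l) (b - 1 - l)).coeff (x, y) = 0
  · rw [h1, zero_sub, neg_ne_zero] at h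
    obtain ⟨l, h2, h3, h4⟩ := sum_mon_coeff_ne_zero h
    omega
  · obtain ⟨l, h2, h3, h4⟩ := sum_mon_coeff_ne_zero h1
    omega

theorem mon_mul_coeff (f : Laurent₂ k) (x y : ℤ) :
    (mon k 1 0 * f).coeff (x, y) = f.coeff (x - 1, y) := by
  rw [mon, AddMonoidAlgebra.coeff_single_mul_apply, one_mul]
  simp [sub_eq_neg_add]

/-- What the Hecke generator in the factors of index `p` and `p + 1` can do to a pure tensor:
either it exchanges the two factors, or it keeps the two colours and does not produce a basis vector
beyond the larger one; moreover the right factor gets smaller if it was the larger one. -/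
structure HeckeStep (p : ℕ) (u s : PureTensor n) : Prop where
  of_ne : ∀ r, r ≠ p → r ≠ p + 1 → s r = u r
  swap_or : (s p = u (p + 1) ∧ s (p + 1) = u p) ∨
    ((s p).2 = (u p).2 ∧ (s (p + 1)).2 = (u (p + 1)).2 ∧
      (pos (s p) ≤ pos (u p) ∨ pos (s p) ≤ pos (u (p + 1))) ∧
      (pos (s (p + 1)) ≤ pos (u p) ∨ pos (s (p + 1)) ≤ pos (u (p + 1))) ∧
      (pos (u p) < pos (u (p + 1)) → pos (s (p + 1)) < pos (u (p + 1))))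

theorem heckeTwo_ne_zero {q : k} {u w : Basis n} {e : Basis n × Basis n}
    (h : heckeTwo q u w e ≠ 0) :
    (e.1 = w ∧ e.2 = u) ∨ (e.1.2 = u.2 ∧ e.2.2 = w.2 ∧
      (pos e.1 ≤ pos u ∨ pos e.1 ≤ pos w) ∧ (pos e.2 ≤ pos u ∨ pos e.2 ≤ pos w) ∧
      (pos u < pos w → pos e.2 < pos w)) := by
  obtain ⟨⟨x, c⟩, ⟨y, c'⟩⟩ := e
  obtain ⟨a, α⟩ := u
  obtain ⟨b, β⟩ := w
  have hmon : ∀ {r : k}, (r • colourTensor β α (mon k b a)) ((x, c), (y, c')) ≠ 0 →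
      ((x, c) : Basis n) = (b, β) ∧ ((y, c') : Basis n) = (a, α) := by
    intro r h
    have h' : colourTensor β α (mon k b a) ((x, c), (y, c')) ≠ 0 := fun e => h (by
      rw [Finsupp.smul_apply, e, smul_zero])
    obtain ⟨h1, h2, h3⟩ := colourTensor_apply_ne_zero h'
    rw [mon, AddMonoidAlgebra.coeff_single, Finsupp.single_apply_ne_zero] at h3
    simp only [Prod.mk.injEq] at h1 h2 h3 ⊢
    exact ⟨⟨h3.1.1, h1⟩, h3.1.2, h2⟩
  have hint : ∀ {r : k} {f : Laurent₂ k}, (r • colourTensor α β f) ((x, c), (y, c')) ≠ 0 →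
      c = α ∧ c' = β ∧ f.coeff (x, y) ≠ 0 := by
    intro r f h
    have h' : colourTensor α β f ((x, c), (y, c')) ≠ 0 := fun e => h (by
      rw [Finsupp.smul_apply, e, smul_zero])
    exact colourTensor_apply_ne_zero h'
  simp only [pos_lt_iff, pos_le_iff]
  rw [heckeTwo] at h
  simp only at h
  split_ifs at h with h1 h2
  · rw [Finsupp.sub_apply, Finsupp.neg_apply] at h
    by_cases h3 : (q • colourTensor β α (mon k b a)) ((x, c), (y, c')) = 0
    · rw [h3, neg_zero, zero_sub, neg_ne_zero] at h
      obtain ⟨rfl, rfl, h4⟩ := hint h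
      have h5 := divDiff_coeff_ne_zero h4
      simp only [Fin.lt_def, Fin.le_def] at *
      refine Or.inr ⟨trivial, trivial, ?_, ?_, ?_⟩ <;> omega
    · exact Or.inl (hmon h3)
  · rw [Finsupp.sub_apply, Finsupp.neg_apply] at h
    by_cases h3 : (colourTensor α β (mon k b a)) ((x, c), (y, c')) = 0
    · rw [h3, neg_zero, zero_sub, neg_ne_zero] at h
      obtain ⟨rfl, rfl, h4⟩ := hint h
      rw [mon_mul_coeff] at h4
      have h5 := divDiff_coeff_ne_zero h4
      simp only [Fin.lt_def, Fin.le_def] at *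
      refine Or.inr ⟨trivial, trivial, ?_, ?_, ?_⟩ <;> omega
    · subst h2
      exact Or.inl (hmon (r := 1) (by rwa [one_smul]))
  · rw [Finsupp.sub_apply, Finsupp.neg_apply] at h
    by_cases h3 : (q • colourTensor β α (mon k b a)) ((x, c), (y, c')) = 0
    · rw [h3, neg_zero, zero_sub, neg_ne_zero] at h
      obtain ⟨rfl, rfl, h4⟩ := hint h
      rw [mon_mul_coeff] at h4
      have h5 := divDiff_coeff_ne_zero h4
      simp only [Fin.lt_def, Fin.le_def] at *
      refine Or.inr ⟨trivial, trivial, ?_, ?_, ?_⟩ <;> omega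
    · exact Or.inl (hmon h3)

theorem exists_heckeStep {q : k} {p : ℕ} {x : FinVector k n} {s : PureTensor n}
    (h : heckeT q p x s ≠ 0) : ∃ u, x u ≠ 0 ∧ HeckeStep p u s := by
  classical
  rw [heckeT, Finsupp.linearCombination_apply, Finsupp.sum_apply] at h
  obtain ⟨u, hu, h1⟩ := Finset.exists_ne_zero_of_sum_ne_zero h
  refine ⟨u, Finsupp.mem_support_iff.1 hu, ?_⟩
  have h2 : (Finsupp.mapDomain (fun e : Basis n × Basis n => put p u e.1 e.2)
      (heckeTwo q (u p) (u (p + 1)))) s ≠ 0 := fun e => h1 (by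
    simp only [Finsupp.smul_apply]
    exact (congrArg (x u • ·) e).trans (smul_zero _))
  obtain ⟨e, he, rfl⟩ := Finset.mem_image.1
    (Finsupp.mapDomain_support (Finsupp.mem_support_iff.2 h2))
  have h3 := heckeTwo_ne_zero (Finsupp.mem_support_iff.1 he)
  exact ⟨fun r h h' => put_of_ne _ _ _ _ h h', by simpa using h3⟩

/-- Induction over the pure tensors that occur in `t · T_σ`. -/
theorem heckeTσ_support_induction {q : k} {M : ℕ} {t : PureTensor n}
    {P : Equiv.Perm ℕ → PureTensor n → Prop} (one : P 1 t)
    (step : ∀ σ : Equiv.Perm ℕ, FixesFrom M σ → ∀ p, p + 1 < M → σ p < σ (p + 1) → ∀ u s,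
      P σ u → HeckeStep p u s → P (σ * adj p) s)
    (σ : SInf) (hσ : FixesFrom M σ) {s : PureTensor n}
    (h : heckeTσ q σ (Finsupp.single t 1) s ≠ 0) : P σ s := by
  refine ascent_induction (M := M) (P := fun σ => ∀ (hm : σ ∈ SInf) (s : PureTensor n),
    heckeTσ q ⟨σ, hm⟩ (Finsupp.single t (1 : k)) s ≠ 0 → P σ s) ?_ ?_ σ σ.2 hσ σ.2 s h
  · intro hm s h
    rw [show (⟨1, hm⟩ : SInf) = 1 from rfl, heckeTσ_one, Finsupp.single_apply_ne_zero] at h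
    rwa [h.1]
  · intro σ hm hM p hp hlt ih hm' s h
    rw [show (⟨σ * adj p, hm'⟩ : SInf) = ⟨σ, hm⟩ * adjS p from rfl,
      heckeTσ_mul_adjS q _ (σ := ⟨σ, hm⟩) hlt] at h
    obtain ⟨u, hu, hs⟩ := exists_heckeStep h
    exact step σ hM p hp hlt u s (ih hm u hu) hs

theorem eq_of_heckeTσ_ne_zero {q : k} {M : ℕ} {t s : PureTensor n} {σ : SInf} (hσ : FixesFrom M σ)
    (h : heckeTσ q σ (Finsupp.single t 1) s ≠ 0) {r : ℕ} (hr : M ≤ r) : s r = t r := by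
  refine heckeTσ_support_induction (M := M) (P := fun _ s => s r = t r) rfl ?_ σ hσ h
  intro _ _ p hp _ u s hu hs
  rw [hs.of_ne r (by omega) (by omega), hu]

theorem colour_sum_eq {q : k} {M : ℕ} {t s : PureTensor n} {σ : SInf} (hσ : FixesFrom M σ)
    (h : heckeTσ q σ (Finsupp.single t 1) s ≠ 0) (f : Fin n → ℤ) :
    ∑ r ∈ Finset.range M, f (s r).2 = ∑ r ∈ Finset.range M, f (t r).2 := by
  refine heckeTσ_support_induction (M := M)
    (P := fun _ s => ∑ r ∈ Finset.range M, f (s r).2 = ∑ r ∈ Finset.range M, f (t r).2)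
    rfl ?_ σ hσ h
  intro _ _ p hp _ u s hu hs
  rw [← hu]
  have split : ∀ g : ℕ → ℤ, ∑ r ∈ Finset.range M, g r =
      (g p + g (p + 1)) + ∑ r ∈ (Finset.range M).filter fun r => r ≠ p ∧ r ≠ p + 1, g r := by
    intro g
    rw [← Finset.sum_pair (by omega : p ≠ p + 1), ← Finset.sum_union]
    · refine Finset.sum_congr ?_ fun _ _ => rfl
      ext i
      simp only [Finset.mem_range, Finset.mem_union, Finset.mem_insert, Finset.mem_singleton,
        Finset.mem_filter]
      omega
    · rw [Finset.disjoint_left]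
      intro i
      simp only [Finset.mem_insert, Finset.mem_singleton, Finset.mem_filter]
      omega
  rw [split, split fun r => f (u r).2]
  congr 1
  · rcases hs.swap_or with ⟨h1, h2⟩ | ⟨h1, h2, -⟩
    · rw [h1, h2, add_comm]
    · rw [h1, h2]
  · refine Finset.sum_congr rfl fun r hr => ?_
    have := (Finset.mem_filter.1 hr).2
    rw [hs.of_ne r this.1 this.2]

/-- If the factor of index `Q` is beyond all the factors before it, then in `t · T_σ` only the factor
to which `σ` moves it can be as large. -/
theorem pos_lt_of_heckeTσ {q : k} {Q : ℕ} {t s : PureTensor n}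
    (ht : ∀ r < Q, pos (t r) < pos (t Q)) {σ : SInf} (hσ : FixesFrom (Q + 1) σ)
    (h : heckeTσ q σ (Finsupp.single t 1) s ≠ 0) :
    ∀ i ≤ Q, pos (s i) ≤ pos (t Q) ∧ ((σ : Equiv.Perm ℕ) i ≠ Q → pos (s i) < pos (t Q)) := by
  refine heckeTσ_support_induction (M := Q + 1) (P := fun σ s =>
    ∀ i ≤ Q, pos (s i) ≤ pos (t Q) ∧ (σ i ≠ Q → pos (s i) < pos (t Q))) ?_ ?_ σ hσ h
  · intro i hi
    rcases hi.lt_or_eq with h | rfl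
    · exact ⟨(ht i h).le, fun _ => ht i h⟩
    · exact ⟨le_rfl, fun h => absurd rfl h⟩
  · intro σ hσ p hp hlt u s ih hs i hi
    have h1 := ih p (by omega)
    have h2 := ih (p + 1) (by omega)
    have h3 := hσ.lt hp
    have h4 := h1.2 (by omega)
    by_cases hip : i = p
    · subst hip
      rw [Equiv.Perm.mul_apply, adj_apply_left]
      rcases hs.swap_or with ⟨h5, h6⟩ | ⟨-, -, h5, h6, h7⟩
      · rw [h5]
        exact h2
      · by_cases hQ : σ (i + 1) = Q
        · exact ⟨by omega, fun h => absurd hQ h⟩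
        · have := h2.2 hQ
          exact ⟨by omega, fun _ => by omega⟩
    by_cases hip' : i = p + 1
    · subst hip'
      rw [Equiv.Perm.mul_apply, adj_apply_right]
      suffices pos (s (p + 1)) < pos (t Q) from ⟨this.le, fun _ => this⟩
      rcases hs.swap_or with ⟨h5, h6⟩ | ⟨-, -, h5, h6, h7⟩
      · rw [h6]
        exact h4
      · omega
    · rw [hs.of_ne i hip hip', Equiv.Perm.mul_apply, adj_apply_of_ne hip hip']
      exact ih i hi

/-- The permutations that contribute to the coefficient of a tensor `s` which agrees with `t` from
the factor of index `R` on only move the factors before it. -/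
theorem fixesFrom_of_heckeTσ_ne_zero {q : k} {R : ℕ} {t s : PureTensor n}
    (ht : ∀ Q, R ≤ Q → ∀ r < Q, pos (t r) < pos (t Q)) (hs : ∀ r, R ≤ r → s r = t r) {σ : SInf}
    (h : heckeTσ q σ (Finsupp.single t 1) s ≠ 0) : FixesFrom R (σ : Equiv.Perm ℕ) := by
  classical
  have hex := exists_fixesFrom σ.2
  by_contra hR
  have hM := Nat.find_spec hex
  obtain ⟨Q, hQ⟩ : ∃ Q, Nat.find hex = Q + 1 := by
    refine Nat.exists_eq_add_one_of_ne_zero fun h0 => hR ?_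
    rw [h0] at hM
    exact hM.mono (Nat.zero_le _)
  rw [hQ] at hM
  have hRQ : R ≤ Q := by
    by_contra hc
    exact hR (hM.mono (by omega))
  have hσQ : (σ : Equiv.Perm ℕ) Q ≠ Q := by
    intro he
    refine Nat.find_min hex (m := Q) (by omega) fun r hr => ?_
    rcases hr.lt_or_eq with h | rfl
    · exact hM r h
    · exact he
  have := (pos_lt_of_heckeTσ (ht Q hRQ) hM h Q le_rfl).2 hσQ
  rw [hs Q hRQ] at this
  exact lt_irrefl _ this

/-- Let the factors of index `P` and `P + 1` of `t` be neighbours that are beyond all the factors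
before them. A tensor in which both of them are replaced by the smaller one does not occur
in any `t · T_σ`. -/
theorem heckeTσ_eq_zero_of_repeated (hn : 2 ≤ n) {q : k} {P : ℕ} {t s : PureTensor n}
    (ht : ∀ r < P, pos (t r) < pos (t P)) (ht' : pos (t P) + 1 = pos (t (P + 1))) {σ : SInf}
    (hσ : FixesFrom (P + 2) σ) (hP : s P = t P) (hP' : s (P + 1) = t P) :
    heckeTσ q σ (Finsupp.single t 1) s = 0 := by
  by_contra h
  have ht2 : ∀ r < P + 1, pos (t r) < pos (t (P + 1)) := by
    intro r hr
    rcases (Nat.lt_succ_iff.1 hr).lt_or_eq with h | rfl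
    · have := ht r h
      omega
    · omega
  have key : ∀ i ≤ P + 1, (pos (s i) ≤ pos (t (P + 1)) ∧
      ((σ : Equiv.Perm ℕ) i ≠ P + 1 → pos (s i) < pos (t (P + 1)))) ∧
      ((σ : Equiv.Perm ℕ) i < P → pos (s i) < pos (t P)) := by
    refine heckeTσ_support_induction (M := P + 2) (P := fun σ s => ∀ i ≤ P + 1,
      (pos (s i) ≤ pos (t (P + 1)) ∧ (σ i ≠ P + 1 → pos (s i) < pos (t (P + 1)))) ∧
      (σ i < P → pos (s i) < pos (t P))) ?_ ?_ σ hσ h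
    · intro i hi
      refine ⟨?_, fun h => ht i h⟩
      rcases hi.lt_or_eq with h | rfl
      · exact ⟨(ht2 i h).le, fun _ => ht2 i h⟩
      · exact ⟨le_rfl, fun h => absurd rfl h⟩
    · intro σ hσ p hp hlt u s ih hs i hi
      have h1 := ih p (by omega)
      have h2 := ih (p + 1) (by omega)
      have h3 := hσ.lt hp
      have h4 := h1.1.2 (by omega)
      by_cases hip : i = p
      · subst hip
        rw [Equiv.Perm.mul_apply, adj_apply_left]
        rcases hs.swap_or with ⟨h5, h6⟩ | ⟨-, -, h5, h6, h7⟩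
        · rw [h5]
          exact h2
        · omega
      by_cases hip' : i = p + 1
      · subst hip'
        rw [Equiv.Perm.mul_apply, adj_apply_right]
        rcases hs.swap_or with ⟨h5, h6⟩ | ⟨-, h8, h5, h6, h7⟩
        · rw [h6]
          exact h1
        · -- if the moved factor is still the largest one, its colour rules out its predecessor
          have h9 : u (p + 1) = t (P + 1) → pos (s (p + 1)) ≠ pos (t P) := by
            intro e1 e2
            exact colour_ne_of_pos hn ht' (by rw [← e1, ← h8, pos_injective e2])
          have h10 : pos (u (p + 1)) = pos (t (P + 1)) → pos (s (p + 1)) ≠ pos (t P) :=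
            fun e => h9 (pos_injective e)
          omega
      · rw [hs.of_ne i hip hip', Equiv.Perm.mul_apply, adj_apply_of_ne hip hip']
        exact ih i hi
  have h1 := (key P (by omega)).2
  have h2 := (key (P + 1) le_rfl).2
  rw [hP] at h1
  rw [hP'] at h2
  have h3 := hσ.lt (r := P) (by omega)
  have h4 := hσ.lt (r := P + 1) (by omega)
  have h5 := ne_of_perm σ P
  by_cases h6 : (σ : Equiv.Perm ℕ) (P + 1) = P + 1
  · have h7 : FixesFrom (P + 1) (σ : Equiv.Perm ℕ) := by
      intro r hr
      rcases hr.lt_or_eq with h | rfl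
      · exact hσ r h
      · exact h6
    have := eq_of_heckeTσ_ne_zero h7 h (le_refl (P + 1))
    rw [hP'] at this
    rw [this] at ht'
    omega
  · have h8 : (σ : Equiv.Perm ℕ) (P + 1) = P := by
      have : ¬ (σ : Equiv.Perm ℕ) (P + 1) < P := fun e => lt_irrefl _ (h2 e)
      omega
    have h9 : (σ : Equiv.Perm ℕ) P = P + 1 := by
      have : ¬ (σ : Equiv.Perm ℕ) P < P := fun e => lt_irrefl _ (h1 e)
      omega
    obtain ⟨τ, rfl⟩ : ∃ τ : SInf, σ = τ * adjS P :=
      ⟨σ * adjS P, Subtype.ext (mul_adj_mul_adj _ _).symm⟩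
    have h10 : (τ : Equiv.Perm ℕ) P = P := by
      have e : (τ : Equiv.Perm ℕ) (adj P (P + 1)) = P := h8
      rwa [adj_apply_right] at e
    have h11 : (τ : Equiv.Perm ℕ) (P + 1) = P + 1 := by
      have e : (τ : Equiv.Perm ℕ) (adj P P) = P + 1 := h9
      rwa [adj_apply_left] at e
    have h12 : FixesFrom (P + 1) (τ : Equiv.Perm ℕ) := by
      intro r hr
      rcases hr.lt_or_eq with h | rfl
      · have h13 : (τ : Equiv.Perm ℕ) (adj P r) = r := hσ r h
        rwa [adj_apply_of_ne (by omega) (by omega)] at h13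
      · exact h11
    rw [heckeTσ_mul_adjS q _ (by omega)] at h
    obtain ⟨u, hu, hs⟩ := exists_heckeStep h
    have h13 := eq_of_heckeTσ_ne_zero h12 hu (le_refl (P + 1))
    rcases hs.swap_or with ⟨h14, -⟩ | ⟨-, h14, -⟩
    · rw [hP, h13] at h14
      rw [h14] at ht'
      omega
    · rw [hP', h13] at h14
      exact colour_ne_of_pos hn ht' h14

end QWedge
namespace QWedge

/-! ### Weights of semi-infinite tensors -/

variable {n : ℕ}

theorem ncard_shift {t : PureTensor n} {C : ℤ} (h : ∀ r, pos (t r) = r + C) (b : Basis n) :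
    ({r : ℕ | t r = b}.ncard : ℤ) = if C ≤ pos b then 1 else 0 := by
  split_ifs with hb
  · have : {r : ℕ | t r = b} = {(pos b - C).toNat} := by
      ext r
      rw [Set.mem_ofPred_eq, Set.mem_singleton_iff, ← pos_injective.eq_iff, h]
      omega
    rw [this, Set.ncard_singleton]
    rfl
  · have : {r : ℕ | t r = b} = ∅ := by
      ext r
      rw [Set.mem_ofPred_eq, ← pos_injective.eq_iff, h]
      simp only [Set.mem_empty_iff_false, iff_false]
      omega
    rw [this, Set.ncard_empty]
    rfl

theorem finite_eq_of_pos {t : PureTensor n} {N : ℕ} {C : ℤ} (h : ∀ r, N ≤ r → pos (t r) = r + C)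
    (b : Basis n) : {r : ℕ | t r = b}.Finite := by
  refine (Set.finite_Iio (max N ((pos b - C).toNat + 1))).subset fun r hr => ?_
  rw [Set.mem_Iio]
  by_contra hc
  have h1 := h r (by omega)
  rw [Set.mem_ofPred_eq] at hr
  rw [hr] at h1
  omega

variable [NeZero n]

theorem pos_periodicTensor (e : ℤ) (r : ℕ) : pos (periodicTensor n e r) = n * e + r := by
  have h1 : ((Fin.rev (Fin.ofNat n r) : Fin n) : ℕ) = n - (r % n + 1) := by simp [Fin.val_rev]
  have h2 : r % n < n := Nat.mod_lt _ (NeZero.pos n)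
  have h3 : (n : ℤ) * ((r / n : ℕ) : ℤ) + ((r % n : ℕ) : ℤ) = r := by
    exact_mod_cast Nat.div_add_mod r n
  simp only [pos, periodicTensor]
  rw [h1, mul_add]
  omega

theorem pos_vacuumTensor (i : Fin n) (r : ℕ) :
    pos (vacuumTensor n i r) = r + (n + ((n - (i : ℕ)) % n : ℕ)) := by
  rw [vacuumTensor, pos_periodicTensor]
  push_cast
  ring

theorem IsSemiInfinite.exists_pos {t : PureTensor n} (h : IsSemiInfinite t) :
    ∃ (N : ℕ) (C : ℤ), ∀ r, N ≤ r → pos (t r) = r + C := by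
  obtain ⟨N, e, h⟩ := h
  refine ⟨N, n * e - N, fun r hr => ?_⟩
  obtain ⟨m, rfl⟩ := Nat.exists_eq_add_of_le hr
  rw [h, pos_periodicTensor]
  push_cast
  ring

theorem isSemiInfinite_of_pos {t : PureTensor n} {N : ℕ} {C : ℤ}
    (h : ∀ r, N ≤ r → pos (t r) = r + C) : IsSemiInfinite t := by
  -- the periodic tensors start at the multiples of `n`
  have hn : (0 : ℤ) < n := by exact_mod_cast NeZero.pos n
  obtain ⟨a, ha⟩ : ∃ a : ℕ, (a : ℤ) = (-(N + C)) % n :=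
    ⟨((-(N + C)) % n).toNat, Int.toNat_of_nonneg (Int.emod_nonneg _ hn.ne')⟩
  refine ⟨N + a, -((-(N + C)) / n), fun r => pos_injective ?_⟩
  rw [pos_periodicTensor, h _ (by omega)]
  have := Int.mul_ediv_add_emod (-(N + C)) n
  push_cast
  rw [mul_neg]
  omega

theorem pos_raise (hn : 2 ≤ n) (j : Fin n) (d : ℤ) : pos (raise j d) = pos (d, j) + 1 := by
  have h1 := val_sub_one hn j
  have h2 := j.2
  simp only [pos, raise, h1]
  by_cases hj : j = 0
  · subst hj
    simp only [if_true, Fin.val_zero, mul_add]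
    omega
  · have hj' : (j : ℕ) ≠ 0 := fun e => hj (Fin.ext (by rw [e, Fin.val_zero]))
    simp only [hj, if_false]
    omega

/-- The weight of a basis vector of colour `c` for `H_j`. -/
def colourWeight (j c : Fin n) : ℤ := (if c = j - 1 then 1 else 0) - if c = j then 1 else 0

theorem zpow_colourWeight {k : Type*} [Field k] (hn : 2 ≤ n) (q : k) (j c : Fin n) :
    q ^ colourWeight j c = colourFactor q (j - 1) j c := by
  have := sub_one_ne hn j
  unfold colourWeight colourFactor
  split_ifs with h1 h2 h2
  · exact absurd (h1.symm.trans h2) this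
  · simp
  · simp
  · simp

/-- The contribution of the exponent `d` to the weight of a tensor. -/
noncomputable def weightAt (j : Fin n) (t : PureTensor n) (d : ℤ) : ℤ :=
  ({r : ℕ | t r = raise j d}.ncard : ℤ) - ({r : ℕ | t r = (d, j)}.ncard : ℤ)

theorem hWeight_eq (j : Fin n) (t : PureTensor n) : hWeight j t = ∑ᶠ d, weightAt j t d := rfl

open Classical in
/-- For a tensor whose factors run through successive basis vectors, both numbers in the definition
of the weight are `0` or `1`. They differ only if the basis vector right before the first factor
is raised to that factor. -/
theorem weightAt_shift (hn : 2 ≤ n) (j : Fin n) {t : PureTensor n} {C : ℤ}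
    (h : ∀ r, pos (t r) = r + C) :
    (Function.support (weightAt j t)).Finite ∧
      hWeight j t = if ∃ d, pos ((d, j) : Basis n) = C - 1 then 1 else 0 := by
  have hw : ∀ d, weightAt j t d = if pos ((d, j) : Basis n) = C - 1 then 1 else 0 := by
    intro d
    rw [weightAt, ncard_shift h, ncard_shift h, pos_raise hn]
    split_ifs <;> omega
  by_cases hd : ∃ d, pos ((d, j) : Basis n) = C - 1
  · rw [if_pos hd]
    obtain ⟨d, hd⟩ := hd
    have hne : ∀ d', d' ≠ d → weightAt j t d' = 0 := by
      intro d' hd'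
      rw [hw, if_neg]
      intro e
      exact hd' (congrArg Prod.fst (pos_injective (e.trans hd.symm)))
    refine ⟨(Set.finite_singleton d).subset fun d' hd' => ?_, ?_⟩
    · by_contra hc
      exact hd' (hne d' hc)
    · rw [hWeight_eq, finsum_eq_single _ d hne, hw, if_pos hd]
  · rw [if_neg hd]
    have hz : weightAt j t = 0 := by
      ext d
      rw [hw, if_neg fun e => hd ⟨d, e⟩]
      rfl
    rw [hWeight_eq, hz]
    simp

open Classical in
theorem ncard_cons {β : Type*} {t : ℕ → β} (b : β) (hfin : {r : ℕ | t (1 + r) = b}.Finite) :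
    ({r : ℕ | t r = b}.ncard : ℤ) =
      (if t 0 = b then 1 else 0) + ({r : ℕ | t (1 + r) = b}.ncard : ℤ) := by
  have himg : {r : ℕ | t r = b} =
      (if t 0 = b then {0} else ∅) ∪ (fun r => 1 + r) '' {r : ℕ | t (1 + r) = b} := by
    ext r
    rcases r with _ | r
    · by_cases h : t 0 = b <;> simp [h]
    · have : ¬ (r + 1 ∈ (if t 0 = b then ({0} : Set ℕ) else ∅)) := by split_ifs <;> simp
      rw [Set.mem_union, or_iff_right this, Set.mem_image]
      constructor
      · intro h
        exact ⟨r, by rwa [Set.mem_ofPred_eq, add_comm], add_comm _ _⟩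
      · rintro ⟨x, hx, hx'⟩
        rw [Set.mem_ofPred_eq, ← hx']
        exact hx
  have hfin' : (if t 0 = b then ({0} : Set ℕ) else ∅).Finite := by split_ifs <;> simp
  rw [himg, Set.ncard_union_eq ?_ hfin' (hfin.image _),
    Set.ncard_image_of_injective _ (add_right_injective 1)]
  · split_ifs <;> simp
  · rw [Set.disjoint_left]
    rintro r h1 ⟨x, -, rfl⟩
    split_ifs at h1 <;> simp at h1

/-- Splitting off the first factor from the weight. -/
theorem weight_cons (j : Fin n) {t : PureTensor n} {N : ℕ} {C : ℤ}
    (h : ∀ r, N ≤ r → pos (t r) = r + C)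
    (hfin : (Function.support (weightAt j fun r => t (1 + r))).Finite) :
    (Function.support (weightAt j t)).Finite ∧
      hWeight j t = colourWeight j (t 0).2 + hWeight j fun r => t (1 + r) := by
  classical
  have h' : ∀ r, N ≤ r → pos (t (1 + r)) = r + (C + 1) := fun r hr => by
    rw [h _ (by omega)]
    push_cast
    ring
  set A : ℤ → ℤ := fun d => if t 0 = raise j d then 1 else 0 with hA
  set B : ℤ → ℤ := fun d => if t 0 = (d, j) then 1 else 0 with hB
  have hsum : weightAt j t = A - B + weightAt j fun r => t (1 + r) := by
    ext d
    simp only [weightAt, Pi.add_apply, Pi.sub_apply, hA, hB]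
    rw [ncard_cons _ (finite_eq_of_pos h' _), ncard_cons _ (finite_eq_of_pos h' _)]
    ring_nf
  have hA' : (Function.support A).Finite ∧ ∑ᶠ d, A d = if (t 0).2 = j - 1 then 1 else 0 := by
    have hne : ∀ d, d ≠ (if j = 0 then (t 0).1 - 1 else (t 0).1) → A d = 0 := by
      intro d hd
      rw [hA]
      refine if_neg fun e => hd ?_
      rw [e, raise]
      split_ifs <;> simp
    refine ⟨(Set.finite_singleton _).subset fun d hd => by_contra fun hc => hd (hne d hc), ?_⟩
    rw [finsum_eq_single _ _ hne]
    simp only [hA]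
    refine if_congr ?_ rfl rfl
    rw [Prod.ext_iff, raise]
    constructor
    · exact fun e => e.2
    · intro e
      refine ⟨?_, e⟩
      simp only
      split_ifs <;> ring
  have hB' : (Function.support B).Finite ∧ ∑ᶠ d, B d = if (t 0).2 = j then 1 else 0 := by
    have hne : ∀ d, d ≠ (t 0).1 → B d = 0 := by
      intro d hd
      rw [hB]
      refine if_neg fun e => hd ?_
      rw [e]
    refine ⟨(Set.finite_singleton _).subset fun d hd => by_contra fun hc => hd (hne d hc), ?_⟩
    rw [finsum_eq_single _ _ hne]
    simp only [hB]
    refine if_congr ?_ rfl rfl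
    rw [Prod.ext_iff]
    simp
  have hAB : (Function.support (A - B)).Finite :=
    (hA'.1.union hB'.1).subset (Function.support_sub _ _)
  constructor
  · rw [hsum]
    exact (hAB.union hfin).subset (Function.support_add _ _)
  · rw [hWeight_eq, hsum, hWeight_eq]
    have e1 := finsum_add_distrib (f := A - B) (g := weightAt j fun r => t (1 + r)) hAB hfin
    have e2 := finsum_sub_distrib (f := A) (g := B) hA'.1 hB'.1
    simp only [Pi.add_apply, Pi.sub_apply] at e1 e2 ⊢
    rw [e1, e2, hA'.2, hB'.2, colourWeight]

open Classical in
/-- The weight of a tail of a semi-infinite tensor is the weight of finitely many factors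
plus that of a tensor running through successive basis vectors. -/
theorem hWeight_tail (hn : 2 ≤ n) (j : Fin n) {t : PureTensor n} {N : ℕ} {C : ℤ}
    (h : ∀ r, N ≤ r → pos (t r) = r + C) {a : ℕ} (ha : a ≤ N) :
    hWeight j (fun r => t (a + r)) = ∑ r ∈ Finset.Ico a N, colourWeight j (t r).2 +
      if ∃ d, pos ((d, j) : Basis n) = N + C - 1 then 1 else 0 := by
  suffices H : (Function.support (weightAt j fun r => t (a + r))).Finite ∧
      hWeight j (fun r => t (a + r)) = ∑ r ∈ Finset.Ico a N, colourWeight j (t r).2 +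
        if ∃ d, pos ((d, j) : Basis n) = N + C - 1 then 1 else 0 from H.2
  induction ha using Nat.decreasingInduction with
  | self =>
    rw [Finset.Ico_self, Finset.sum_empty, zero_add]
    refine weightAt_shift hn j fun r => ?_
    rw [h _ (by omega)]
    push_cast
    ring
  | of_succ a ha ih =>
    have e : (fun r => t (a + 1 + r)) = fun r => t (a + (1 + r)) := by
      ext r : 1
      rw [add_assoc]
    rw [e] at ih
    have h1 := weight_cons j (t := fun r => t (a + r)) (N := N) (C := a + C)
      (fun r hr => by
        rw [h _ (by omega)]
        push_cast
        ring) ih.1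
    refine ⟨h1.1, ?_⟩
    rw [h1.2, ih.2, Finset.sum_eq_sum_Ico_succ_bot ha, add_assoc, add_zero]

/-- Splitting off the factors of index between `p` and `M` from the weight. -/
theorem hWeight_tail_split (hn : 2 ≤ n) (j : Fin n) {t : PureTensor n} {N : ℕ} {C : ℤ}
    (h : ∀ r, N ≤ r → pos (t r) = r + C) {p M : ℕ} (hp : p < M) :
    hWeight j (fun r => t (p + 1 + r)) =
      ∑ r ∈ Finset.Ioo p M, colourWeight j (t r).2 + hWeight j fun r => t (M + r) := by
  have h' : ∀ r, max N M ≤ r → pos (t r) = r + C := fun r hr => h r (by omega)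
  rw [hWeight_tail hn j h' (a := p + 1) (by omega), hWeight_tail hn j h' (a := M) (by omega),
    ← add_assoc]
  congr 1
  rw [← Finset.sum_Ico_consecutive _ (show p + 1 ≤ M by omega) (le_max_right N M)]
  congr 1

/-- Tensors that agree from some index on have the same weight if the weights of their other factors
have the same sum. -/
theorem hWeight_congr (hn : 2 ≤ n) (j : Fin n) {s t : PureTensor n} {N : ℕ} {C : ℤ}
    (h : ∀ r, N ≤ r → pos (t r) = r + C) (hs : ∀ r, N ≤ r → s r = t r)
    (hsum : ∑ r ∈ Finset.range N, colourWeight j (s r).2 =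
      ∑ r ∈ Finset.range N, colourWeight j (t r).2) : hWeight j s = hWeight j t := by
  have h1 := hWeight_tail hn j (t := s) (N := N) (C := C)
    (fun r hr => by rw [hs r hr, h r hr]) (Nat.zero_le N)
  have h2 := hWeight_tail hn j h (Nat.zero_le N)
  simp only [zero_add, ← Finset.range_eq_Ico] at h1 h2
  rw [h1, h2, hsum]

theorem hWeight_vacuumTensor (hn : 2 ≤ n) (i j : Fin n) :
    hWeight j (vacuumTensor n i) = fundamentalWeight i j := by
  classical
  rw [(weightAt_shift hn j (pos_vacuumTensor i)).2, fundamentalWeight, Pi.single_apply]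
  have hi := i.2
  -- the basis vector that precedes the vacuum tensor has colour `i`
  have hv : ∃ d, pos ((d, i) : Basis n) = (n + ((n - (i : ℕ)) % n : ℕ) : ℤ) - 1 := by
    by_cases h0 : (i : ℕ) = 0
    · refine ⟨0, ?_⟩
      rw [h0, Nat.sub_zero, Nat.mod_self]
      simp only [pos, h0]
      push_cast
      ring
    · refine ⟨1, ?_⟩
      rw [Nat.mod_eq_of_lt (by omega)]
      simp only [pos]
      omega
  refine if_congr ?_ rfl rfl
  constructor
  · rintro ⟨d, hd⟩
    obtain ⟨d', hd'⟩ := hv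
    exact congrArg Prod.snd (pos_injective (hd.trans hd'.symm))
  · rintro rfl
    exact hv

end QWedge
namespace QWedge

/-! ### Antisymmetrization -/

variable {k : Type*} [Field k] {n : ℕ}

theorem finite_fixesFrom (M : ℕ) : {σ : SInf | FixesFrom M (σ : Equiv.Perm ℕ)}.Finite := by
  refine Set.Finite.of_injOn (f := fun σ : SInf => fun i : Fin M => (σ : Equiv.Perm ℕ) i)
    (t := Set.univ.pi fun _ => Set.Iio M) ?_ ?_ (Set.Finite.pi fun _ => Set.finite_Iio M)
  · intro σ hσ i _
    exact FixesFrom.lt hσ i.2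
  · intro σ hσ τ hτ h
    refine Subtype.ext (Equiv.ext fun r => ?_)
    by_cases hr : r < M
    · exact congrFun h ⟨r, hr⟩
    · exact (hσ r (not_lt.1 hr)).trans (hτ r (not_lt.1 hr)).symm

/-- The permutations that only move numbers below `M`. -/
noncomputable def permsBelow (M : ℕ) : Finset SInf := (finite_fixesFrom M).toFinset

theorem mem_permsBelow {M : ℕ} {σ : SInf} : σ ∈ permsBelow M ↔ FixesFrom M (σ : Equiv.Perm ℕ) :=
  (finite_fixesFrom M).mem_toFinset

theorem heckeTσ_smul (q : k) (σ : SInf) (a : k) (x : FinVector k n) :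
    heckeTσ q σ (a • x) = a • heckeTσ q σ x := by
  obtain ⟨A, hA⟩ := heckeWord_linear (n := n) q (reducedWord σ)
  rw [heckeTσ, heckeTσ, hA, hA, map_smul]

theorem heckeTσ_sum (q : k) (σ : SInf) {ι : Type*} (s : Finset ι) (f : ι → FinVector k n) :
    heckeTσ q σ (∑ i ∈ s, f i) = ∑ i ∈ s, heckeTσ q σ (f i) := by
  obtain ⟨A, hA⟩ := heckeWord_linear (n := n) q (reducedWord σ)
  simp only [heckeTσ, hA, map_sum]

theorem divDiff_self (a : ℤ) : divDiff k a a = 0 := by simp [divDiff]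

theorem heckeT_of_eq (q : k) {p : ℕ} {t : PureTensor n} (h : t p = t (p + 1)) :
    heckeT q p (Finsupp.single t 1) = -Finsupp.single t 1 := by
  have h1 : heckeTwo q (t p) (t (p + 1)) = -Finsupp.single (t p, t (p + 1)) (1 : k) := by
    rw [← h, heckeTwo, if_neg (lt_irrefl _), if_pos rfl, divDiff_self, mul_zero]
    simp [colourTensor, mon]
  rw [heckeT_single, h1, ← Finsupp.mapDomain.addMonoidHom_apply, map_neg]
  simp

/-- Left multiplication by the transposition of two equal factors pairs off the summands. -/
theorem sum_heckeTσ_eq_zero (q : k) {t : PureTensor n} {p M : ℕ} (hp : p + 1 < M)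
    (h : t p = t (p + 1)) : ∑ σ ∈ permsBelow M, heckeTσ q σ (Finsupp.single t (1 : k)) = 0 := by
  have hadj : ∀ σ : SInf, adjS p * (adjS p * σ) = σ := fun σ => by
    rw [← mul_assoc, show adjS p * adjS p = 1 from Subtype.ext (adj_mul_self p), one_mul]
  have hpair : ∀ σ : SInf, (σ : Equiv.Perm ℕ)⁻¹ p < (σ : Equiv.Perm ℕ)⁻¹ (p + 1) →
      heckeTσ q (adjS p * σ) (Finsupp.single t (1 : k)) =
        -heckeTσ q σ (Finsupp.single t (1 : k)) := by
    intro σ hσ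
    rw [heckeTσ_adjS_mul q _ hσ, heckeT_of_eq q h, ← neg_one_smul k (Finsupp.single t (1 : k)),
      heckeTσ_smul, neg_one_smul]
  refine Finset.sum_involution (fun σ _ => adjS p * σ) ?_ ?_ ?_ ?_
  · intro σ _
    rcases lt_or_gt_of_ne (ne_of_perm (σ : Equiv.Perm ℕ)⁻¹ p) with hlt | hlt
    · rw [hpair σ hlt, add_neg_cancel]
    · have h1 := hpair (adjS p * σ) (by
        have e : ((adjS p * σ : SInf) : Equiv.Perm ℕ)⁻¹ = (σ : Equiv.Perm ℕ)⁻¹ * adj p := by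
          rw [Subgroup.coe_mul, mul_inv_rev]
          congr 1
        rw [e, Equiv.Perm.mul_apply, Equiv.Perm.mul_apply, adj_apply_left, adj_apply_right]
        exact hlt)
      rw [hadj] at h1
      rw [h1, neg_add_cancel]
  · intro σ _ _ he
    have h1 : adjS p = 1 := mul_eq_right.1 he
    have h2 : adj p p = p := congrArg (fun τ : SInf => (τ : Equiv.Perm ℕ) p) h1
    rw [adj_apply_left] at h2
    omega
  · intro σ hσ
    rw [mem_permsBelow] at hσ ⊢
    exact (fixesFrom_adj hp).mul hσ
  · intro σ _
    exact hadj σ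

/-- From some index on, all factors of a semi-infinite tensor are beyond all the previous ones. -/
theorem IsSemiInfinite.exists_increasing [NeZero n] {t : PureTensor n} (h : IsSemiInfinite t) :
    ∃ R, ∀ Q, R ≤ Q → ∀ r < Q, pos (t r) < pos (t Q) := by
  obtain ⟨N, C, h⟩ := h.exists_pos
  obtain ⟨B, hB⟩ := ((Finset.range N).image fun r => pos (t r)).exists_le
  refine ⟨max N (B - C + 1).toNat, fun Q hQ r hr => ?_⟩
  rw [h Q (by omega)]
  by_cases hrN : r < N
  · have := hB _ (Finset.mem_image_of_mem (fun r => pos (t r)) (Finset.mem_range.2 hrN))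
    omega
  · rw [h r (by omega)]
    omega

/-- The `q`-antisymmetrization of a pure tensor, coefficient by coefficient. -/
noncomputable def antisymmetrization (q : k) (t : PureTensor n) : FormalVector k n :=
  fun s => ∑ᶠ σ : SInf, heckeTσ q σ (Finsupp.single t (1 : k)) s

theorem support_subset_permsBelow {q : k} {R : ℕ} {t s : PureTensor n}
    (ht : ∀ Q, R ≤ Q → ∀ r < Q, pos (t r) < pos (t Q)) (hs : ∀ r, R ≤ r → s r = t r) :
    (Function.support fun σ : SInf => heckeTσ q σ (Finsupp.single t (1 : k)) s) ⊆
      permsBelow R := fun _ hσ =>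
  mem_permsBelow.2 (fixesFrom_of_heckeTσ_ne_zero ht hs hσ)

theorem antisymmetrization_eq_sum {q : k} {R : ℕ} {t s : PureTensor n}
    (ht : ∀ Q, R ≤ Q → ∀ r < Q, pos (t r) < pos (t Q)) (hs : ∀ r, R ≤ r → s r = t r) :
    antisymmetrization q t s =
      (∑ σ ∈ permsBelow R, heckeTσ q σ (Finsupp.single t (1 : k))) s := by
  rw [antisymmetrization, finsum_eq_sum_of_support_subset _ (support_subset_permsBelow ht hs),
    Finsupp.finsetSum_apply]

theorem exists_eq_of_heckeTσ_ne_zero {q : k} {t s : PureTensor n} {σ : SInf}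
    (h : heckeTσ q σ (Finsupp.single t (1 : k)) s ≠ 0) : ∃ R, ∀ r, R ≤ r → s r = t r := by
  obtain ⟨R, hR⟩ := exists_fixesFrom σ.2
  exact ⟨R, fun r hr => eq_of_heckeTσ_ne_zero hR h hr⟩

theorem exists_of_antisymmetrization_ne_zero {q : k} {t s : PureTensor n}
    (h : antisymmetrization q t s ≠ 0) :
    ∃ σ : SInf, heckeTσ q σ (Finsupp.single t (1 : k)) s ≠ 0 := by
  by_contra! hc
  exact h (by simp [antisymmetrization, hc])

theorem isQAntisymmetrization [NeZero n] (q : k) {t : PureTensor n} (ht : IsSemiInfinite t) :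
    IsQAntisymmetrization q t (antisymmetrization q t) := by
  intro s
  refine ⟨?_, rfl⟩
  obtain ⟨R, hR⟩ := ht.exists_increasing
  by_cases hs : ∃ R', ∀ r, R' ≤ r → s r = t r
  · obtain ⟨R', hR'⟩ := hs
    exact (permsBelow (max R R')).finite_toSet.subset (support_subset_permsBelow
      (fun Q hQ => hR Q (by omega)) (fun r hr => hR' r (by omega)))
  · convert Set.finite_empty
    refine Set.eq_empty_of_forall_notMem fun σ hσ => hs (exists_eq_of_heckeTσ_ne_zero hσ)

theorem antisymmetrization_eq_zero [NeZero n] (q : k) {t : PureTensor n} (ht : IsSemiInfinite t)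
    {p : ℕ} (hp : t p = t (p + 1)) : antisymmetrization q t = 0 := by
  ext s
  by_contra hne
  obtain ⟨σ, hσ⟩ := exists_of_antisymmetrization_ne_zero hne
  obtain ⟨R, hR⟩ := ht.exists_increasing
  obtain ⟨R', hR'⟩ := exists_eq_of_heckeTσ_ne_zero hσ
  apply hne
  rw [antisymmetrization_eq_sum (R := max (max R R') (p + 2)) (fun Q hQ => hR Q (by omega))
    (fun r hr => hR' r (by omega)), sum_heckeTσ_eq_zero q (by omega) hp]
  rfl

/-! ### The vacuum vector -/

theorem raiseTrunc_heckeTσ [NeZero n] (hn : 2 ≤ n) {q : k} (hq : q ≠ 0) (j : Fin n) {M : ℕ}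
    {σ : SInf} (hσ : FixesFrom M (σ : Equiv.Perm ℕ)) (x : FinVector k n) :
    raiseTrunc q j M (heckeTσ q σ x) = heckeTσ q σ (raiseTrunc q j M x) := by
  refine ascent_induction (M := M) (P := fun σ => ∀ hm : σ ∈ SInf,
    raiseTrunc q j M (heckeTσ q ⟨σ, hm⟩ x) = heckeTσ q ⟨σ, hm⟩ (raiseTrunc q j M x))
    ?_ ?_ σ σ.2 hσ σ.2
  · intro hm
    rw [show (⟨1, hm⟩ : SInf) = 1 from rfl, heckeTσ_one, heckeTσ_one]
  · intro σ hm _ p hp hlt ih hm'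
    rw [show (⟨σ * adj p, hm'⟩ : SInf) = ⟨σ, hm⟩ * adjS p from rfl,
      heckeTσ_mul_adjS q _ (σ := ⟨σ, hm⟩) hlt, heckeTσ_mul_adjS q _ (σ := ⟨σ, hm⟩) hlt, ← ih hm,
      heckeT_raiseTrunc hn hq j hp]

theorem update_raise_ne [NeZero n] (hn : 2 ≤ n) {j : Fin n} {b : Basis n} (h : b.2 = j) :
    raise j b.1 ≠ b := by
  intro e
  have := congrArg Prod.snd e
  simp only [raise] at this
  exact sub_one_ne hn j (this.trans h)

theorem pos_raise_of_colour [NeZero n] (hn : 2 ≤ n) {j : Fin n} {b : Basis n} (h : b.2 = j) :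
    pos (raise j b.1) = pos b + 1 := by
  rw [pos_raise hn, ← h]

/-- Raising one factor of a sequence of successive basis vectors makes it equal to the next one. If
the last factor is not raised, the antisymmetrization of all terms vanishes. -/
theorem sum_heckeTσ_raiseTrunc [NeZero n] (hn : 2 ≤ n) (q : k) {j : Fin n} {P : ℕ}
    {t : PureTensor n} (ht : ∀ r, pos (t r) + 1 = pos (t (r + 1))) (hj : (t P).2 ≠ j) :
    ∑ σ ∈ permsBelow (P + 1), heckeTσ q σ (raiseTrunc q j (P + 1) (Finsupp.single t 1)) = 0 := by
  rw [raiseTrunc, Finsupp.linearCombination_single, one_smul]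
  simp only [heckeTσ_sum]
  rw [Finset.sum_comm]
  refine Finset.sum_eq_zero fun p hp => ?_
  rw [Finset.mem_range] at hp
  by_cases hc : (t p).2 = j
  · have hpP : p ≠ P := fun e => hj (e ▸ hc)
    have h1 : ∀ a : k, Finsupp.single (Function.update t p (raise j (t p).1)) a =
        a • Finsupp.single (Function.update t p (raise j (t p).1)) (1 : k) := fun a => by simp
    rw [raiseAt, if_pos hc, h1]
    simp only [heckeTσ_smul]
    rw [← Finset.smul_sum, sum_heckeTσ_eq_zero q (p := p) (by omega), smul_zero]
    rw [Function.update_self, Function.update_of_ne (by omega)]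
    exact pos_injective ((pos_raise_of_colour hn hc).trans (ht p))
  · rw [raiseAt, if_neg hc]
    refine Finset.sum_eq_zero fun σ _ => ?_
    have := heckeTσ_smul q σ 0 (0 : FinVector k n)
    rwa [zero_smul, zero_smul] at this

/-- `s` arises from `u` by applying `E_j` to the factor of index `p`. -/
def RaisesTo [NeZero n] (j : Fin n) (p : ℕ) (u s : PureTensor n) : Prop :=
  (u p).2 = j ∧ s = Function.update u p (raise j (u p).1)

theorem RaisesTo.unique [NeZero n] (hn : 2 ≤ n) {j : Fin n} {p p' : ℕ} {u s : PureTensor n}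
    (h : RaisesTo j p u s) (h' : RaisesTo j p' u s) : p = p' := by
  by_contra hne
  have h1 := congrFun h.2 p
  have h2 := congrFun h'.2 p
  rw [Function.update_self] at h1
  rw [Function.update_of_ne hne] at h2
  exact update_raise_ne hn h.1 (h1.symm.trans h2)

open Classical in
theorem actEAt_apply [NeZero n] (q : k) (j : Fin n) (u s : PureTensor n) (p : ℕ) :
    actEAt q j u p s =
      if RaisesTo j p u s then q ^ hWeight j (fun r => u (p + 1 + r)) else 0 := by
  rw [actEAt, RaisesTo]
  split_ifs with h1 h2 h2
  · rw [Pi.smul_apply, h2.2, Pi.single_eq_same, smul_eq_mul, mul_one]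
  · rw [Pi.smul_apply, Pi.single_eq_of_ne (fun e => h2 ⟨h1, e⟩), smul_zero]
  · exact absurd h2.1 h1
  · rfl

open Classical in
theorem raiseAt_apply [NeZero n] (q : k) (j : Fin n) (M : ℕ) (u s : PureTensor n) (p : ℕ) :
    raiseAt q j M p u s = if RaisesTo j p u s then
      ∏ r ∈ Finset.Ioo p M, colourFactor q (j - 1) j (u r).2 else 0 := by
  rw [raiseAt, RaisesTo]
  split_ifs with h1 h2 h2
  · rw [h2.2, Finsupp.single_eq_same]
  · rw [Finsupp.single_eq_of_ne (fun e => h2 ⟨h1, e⟩)]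
  · exact absurd h2.1 h1
  · rfl

theorem actE_apply_of_raisesTo [NeZero n] (hn : 2 ≤ n) (q : k) {j : Fin n} {u s : PureTensor n}
    {p : ℕ} (h : RaisesTo j p u s) :
    actE q j u s = q ^ hWeight j (fun r => u (p + 1 + r)) := by
  rw [actE, finsum_eq_single _ p, actEAt_apply, if_pos h]
  intro p' hp'
  rw [actEAt_apply, if_neg fun h' => hp' (h'.unique hn h)]

theorem actE_apply_eq_zero [NeZero n] (q : k) {j : Fin n} {u s : PureTensor n}
    (h : ∀ p, ¬RaisesTo j p u s) : actE q j u s = 0 := by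
  rw [actE]
  simp only [actEAt_apply, if_neg (h _)]
  exact finsum_zero

theorem raiseTrunc_single_apply [NeZero n] (q : k) (j : Fin n) (M : ℕ) (u s : PureTensor n) :
    raiseTrunc q j M (Finsupp.single u (1 : k)) s =
      ∑ p ∈ Finset.range M, raiseAt q j M p u s := by
  rw [raiseTrunc, Finsupp.linearCombination_single, one_smul, Finsupp.finsetSum_apply]

/-- The terms of the coefficient of `s` in `E_j` of an antisymmetrization, in finite form. If `s` agrees
with `t` from the factor of index `P` on, only permutations of the factors up to `P` contribute, and
only these factors can be raised; the factors after them contribute the same power of `q` to all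
terms. -/
theorem smul_actE_apply [NeZero n] (hn : 2 ≤ n) {q : k} (hq : q ≠ 0) (j : Fin n) {P : ℕ}
    {t s : PureTensor n} {C : ℤ} (ht : ∀ r, pos (t r) = r + C) (hs : ∀ r, P ≤ r → s r = t r)
    (u : PureTensor n) :
    (antisymmetrization q t u • actE q j u) s =
      q ^ hWeight j (fun r => t (P + 1 + r)) *
        ((∑ σ ∈ permsBelow (P + 1), heckeTσ q σ (Finsupp.single t (1 : k))) u *
          raiseTrunc q j (P + 1) (Finsupp.single u (1 : k)) s) := by
  have hinc : ∀ Q, ∀ r < Q, pos (t r) < pos (t Q) := by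
    intro Q r hr
    rw [ht, ht]
    omega
  rw [Pi.smul_apply, smul_eq_mul, raiseTrunc_single_apply]
  by_cases hex : ∃ p, RaisesTo j p u s
  · obtain ⟨p, hp⟩ := hex
    have hus : ∀ r, r ≠ p → u r = s r := fun r hr => by rw [hp.2, Function.update_of_ne hr]
    by_cases hpP : p < P + 1
    · have hut : ∀ r, P + 1 ≤ r → u r = t r := fun r hr => by
        rw [hus r (by omega), hs r (by omega)]
      have htail : (fun r => u (P + 1 + r)) = fun r => t (P + 1 + r) := by
        ext r : 1
        exact hut _ (by omega)
      rw [antisymmetrization_eq_sum (R := P + 1) (fun Q _ => hinc Q) hut,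
        actE_apply_of_raisesTo hn q hp, Finset.sum_eq_single p, raiseAt_apply, if_pos hp,
        hWeight_tail_split hn j (t := u) (N := P + 1) (C := C)
          (fun r hr => by rw [hut r hr, ht]) hpP, htail, zpow_add₀ hq]
      · have hz : ∀ s : Finset ℕ, q ^ ∑ r ∈ s, colourWeight j (u r).2 =
            ∏ r ∈ s, colourFactor q (j - 1) j (u r).2 := by
          intro s
          induction s using Finset.induction_on with
          | empty => simp
          | insert a s ha ih =>
            rw [Finset.sum_insert ha, Finset.prod_insert ha, zpow_add₀ hq, ih,
              zpow_colourWeight hn]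
        rw [hz]
        ring
      · intro p' _ hp'
        rw [raiseAt_apply, if_neg fun h' => hp' (h'.unique hn hp)]
      · intro h
        exact absurd (Finset.mem_range.2 hpP) h
    · -- Here the raised factor of `u` has an index beyond `P`, and before raising it is equal to the
      -- factor on its left. Such a tensor does not occur in the antisymmetrization of `t`.
      have h1 : antisymmetrization q t u = 0 := by
        by_contra hne
        obtain ⟨σ, hσ⟩ := exists_of_antisymmetrization_ne_zero hne
        obtain ⟨p, rfl⟩ : ∃ p', p = p' + 1 := ⟨p - 1, by omega⟩
        apply hσ
        refine heckeTσ_eq_zero_of_repeated hn (P := p) (hinc p) ?_ ?_ ?_ ?_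
        · rw [ht, ht]
          push_cast
          ring
        · refine fixesFrom_of_heckeTσ_ne_zero (R := p + 2) (fun Q _ => hinc Q) (fun r hr => ?_) hσ
          rw [hus r (by omega), hs r (by omega)]
        · rw [hus p (by omega), hs p (by omega)]
        · apply pos_injective
          have h2 := congrArg pos (congrFun hp.2 (p + 1))
          rw [Function.update_self, pos_raise_of_colour hn hp.1, hs _ (by omega), ht] at h2
          rw [ht]
          push_cast at h2
          omega
      have h2 : ∑ p' ∈ Finset.range (P + 1), raiseAt q j (P + 1) p' u s = 0 := by
        refine Finset.sum_eq_zero fun p' hp' => ?_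
        rw [raiseAt_apply, if_neg]
        intro h'
        have := h'.unique hn hp
        rw [Finset.mem_range] at hp'
        omega
      rw [h1, zero_mul, h2, mul_zero, mul_zero]
  · push Not at hex
    have h2 : ∑ p ∈ Finset.range (P + 1), raiseAt q j (P + 1) p u s = 0 :=
      Finset.sum_eq_zero fun p _ => by rw [raiseAt_apply, if_neg (hex p)]
    rw [actE_apply_eq_zero q hex, mul_zero, h2, mul_zero, mul_zero]

theorem formallyMapsTo_actE [NeZero n] (hn : 2 ≤ n) {q : k} (hq : q ≠ 0) (j : Fin n)
    {t : PureTensor n} {C : ℤ} (ht : ∀ r, pos (t r) = r + C) :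
    FormallyMapsTo (actE q j) (antisymmetrization q t) 0 := by
  intro s
  by_cases hs : ∃ R, ∀ r, R ≤ r → s r = t r
  · obtain ⟨R, hR⟩ := hs
    have hsucc : ∀ r, pos (t r) + 1 = pos (t (r + 1)) := fun r => by
      rw [ht, ht]
      push_cast
      ring
    -- Adjacent factors of `t` have different colours, so `E_j` kills one of any two of them. The
    -- truncation is made after such a factor.
    obtain ⟨P, hP, hPj⟩ : ∃ P, R ≤ P ∧ (t P).2 ≠ j := by
      by_cases h : (t R).2 = j
      · exact ⟨R + 1, by omega, fun h' => colour_ne_of_pos hn (hsucc R) (h.trans h'.symm)⟩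
      · exact ⟨R, le_rfl, h⟩
    set x := ∑ σ ∈ permsBelow (P + 1), heckeTσ q σ (Finsupp.single t (1 : k)) with hx
    have hx0 : raiseTrunc q j (P + 1) x = 0 := by
      rw [hx, map_sum, ← sum_heckeTσ_raiseTrunc hn q hsucc hPj]
      exact Finset.sum_congr rfl fun σ hσ => raiseTrunc_heckeTσ hn hq j (mem_permsBelow.1 hσ) _
    have hterm := smul_actE_apply hn hq j ht (s := s) (P := P) fun r hr => hR r (by omega)
    rw [← hx] at hterm
    have hsub : (Function.support fun u => (antisymmetrization q t u • actE q j u) s) ⊆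
        x.support := by
      intro u hu
      rw [Function.mem_support, hterm] at hu
      exact Finsupp.mem_support_iff.2 fun e => hu (by rw [e, zero_mul, mul_zero])
    refine ⟨x.support.finite_toSet.subset hsub, ?_⟩
    rw [finsum_eq_sum_of_support_subset _ hsub]
    simp only [hterm]
    rw [← Finset.mul_sum]
    have h1 : raiseTrunc q j (P + 1) x s =
        ∑ u ∈ x.support, x u * raiseTrunc q j (P + 1) (Finsupp.single u (1 : k)) s := by
      conv_lhs => rw [← Finsupp.sum_single x, Finsupp.sum, map_sum, Finsupp.finsetSum_apply]
      refine Finset.sum_congr rfl fun u _ => ?_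
      rw [← Finsupp.smul_single_one u (x u), map_smul, Finsupp.smul_apply, smul_eq_mul]
    rw [← h1, hx0]
    simp
  · have hz : ∀ u, (antisymmetrization q t u • actE q j u) s = 0 := by
      intro u
      rw [Pi.smul_apply, smul_eq_mul]
      by_contra hne
      obtain ⟨σ, hσ⟩ := exists_of_antisymmetrization_ne_zero (left_ne_zero_of_mul hne)
      obtain ⟨R, hR⟩ := exists_eq_of_heckeTσ_ne_zero hσ
      by_cases hex : ∃ p, RaisesTo j p u s
      · obtain ⟨p, hp⟩ := hex
        refine hs ⟨max R (p + 1), fun r hr => ?_⟩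
        rw [hp.2, Function.update_of_ne (by omega), hR r (by omega)]
      · push Not at hex
        exact right_ne_zero_of_mul hne (actE_apply_eq_zero q hex)
    simp [hz]

open Classical in
theorem formallyMapsTo_actK [NeZero n] (hn : 2 ≤ n) (q : k) (j : Fin n)
    {t : PureTensor n} {C : ℤ} (ht : ∀ r, pos (t r) = r + C) :
    FormallyMapsTo (actK q j) (antisymmetrization q t)
      (q ^ hWeight j t • antisymmetrization q t) := by
  intro s
  have hne : ∀ u, u ≠ s → (antisymmetrization q t u • actK q j u) s = 0 := by
    intro u hu
    rw [actK, Pi.smul_apply, Pi.smul_apply, Pi.single_eq_of_ne hu.symm, smul_zero, smul_zero]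
  refine ⟨(Set.finite_singleton s).subset fun u hu => by_contra fun hc => hu (hne u hc), ?_⟩
  rw [finsum_eq_single _ s hne, actK, Pi.smul_apply, Pi.smul_apply, Pi.single_eq_same,
    Pi.smul_apply, smul_eq_mul, smul_eq_mul, smul_eq_mul, mul_one, mul_comm]
  by_cases h0 : antisymmetrization q t s = 0
  · rw [h0, mul_zero, mul_zero]
  · obtain ⟨σ, hσ⟩ := exists_of_antisymmetrization_ne_zero h0
    obtain ⟨M, hM⟩ := exists_fixesFrom σ.2
    rw [hWeight_congr hn j (s := s) (t := t) (N := M) (C := C) (fun r _ => ht r)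
      (fun r hr => eq_of_heckeTσ_ne_zero hM hσ hr) (colour_sum_eq hM hσ _)]

theorem antisymmetrization_self {q : k} {t : PureTensor n}
    (ht : ∀ Q, ∀ r < Q, pos (t r) < pos (t Q)) : antisymmetrization q t t = 1 := by
  have h1 : permsBelow 0 = {1} := by
    ext σ
    rw [mem_permsBelow, Finset.mem_singleton]
    constructor
    · intro h
      exact Subtype.ext (Equiv.ext fun r => h r (Nat.zero_le _))
    · rintro rfl r _
      rfl
  rw [antisymmetrization_eq_sum (R := 0) (fun Q _ => ht Q) (fun _ _ => rfl), h1,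
    Finset.sum_singleton, heckeTσ_one, Finsupp.single_eq_same]

theorem isHighestWeightVector_vacuum [NeZero n] (hn : 2 ≤ n) {q : k} (hq : q ≠ 0) (i : Fin n) :
    IsHighestWeightVector q (fundamentalWeight i) (antisymmetrization q (vacuumTensor n i)) where
  ne_zero h := by
    have h1 := antisymmetrization_self (q := q) (t := vacuumTensor n i) fun Q r hr => by
      rw [pos_vacuumTensor, pos_vacuumTensor]
      omega
    rw [h] at h1
    exact zero_ne_one h1
  semiInfinite s hs := by
    obtain ⟨σ, hσ⟩ := exists_of_antisymmetrization_ne_zero hs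
    obtain ⟨R, hR⟩ := exists_eq_of_heckeTσ_ne_zero hσ
    exact isSemiInfinite_of_pos fun r hr => by rw [hR r hr, pos_vacuumTensor]
  actE_eq_zero j := formallyMapsTo_actE hn hq j (pos_vacuumTensor i)
  actK_eq j := by
    rw [← hWeight_vacuumTensor hn i j]
    exact formallyMapsTo_actK hn q j (pos_vacuumTensor i)

end QWedge

theorem mainTheorem1 {k : Type*} [Field k] (q : k) (hq : q ≠ 0) (n : ℕ) [NeZero n] (hn : 2 ≤ n) :
    (∀ i : Fin n, ∃ v : QWedge.FormalVector k n,
      QWedge.IsQAntisymmetrization q (QWedge.vacuumTensor n i) v ∧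
      QWedge.IsHighestWeightVector q (QWedge.fundamentalWeight i) v) ∧
    (∀ t : QWedge.PureTensor n, QWedge.IsSemiInfinite t → (∃ p : ℕ, t p = t (p + 1)) →
      QWedge.IsQAntisymmetrization q t 0) := by
  refine ⟨fun i => ⟨QWedge.antisymmetrization q (QWedge.vacuumTensor n i), ?_,
    QWedge.isHighestWeightVector_vacuum hn hq i⟩, ?_⟩
  · exact QWedge.isQAntisymmetrization q
      (QWedge.isSemiInfinite_of_pos (N := 0) fun r _ => QWedge.pos_vacuumTensor i r)
  · rintro t ht ⟨p, hp⟩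
    rw [← QWedge.antisymmetrization_eq_zero q ht hp]
    exact QWedge.isQAntisymmetrization q ht
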